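/- **Conventions.** Let $r\ge 0$ be an integer. A graph $\Gamma$ may have loops and multiple edges; if $r$ is odd, every edge is oriented. For a set $X$, let $\Lambda^r[X]$ be the graded commutative ring over $\mathbb Z$ generated by elements $e_x$ ($x\in X$) of degree $r-1$ with the relations $e_xe_y=(-1)^{r-1}e_ye_x$ and $e_x^2=0$ (the exterior algebra on $X$ if $r$ is even, the polynomial ring on $X$ modulo the squares of the variables if $r$ is odd). Put $\Lambda^r(\Gamma)=\Lambda^r[E(\Gamma)]$. A circuit $w$ of length $k\ge 1$ is a closed walk $v_0,w_0,v_1,w_1,\dots,w_{k-1},v_k=v_0$ in which the edge $w_i$ joins $v_i$ and $v_{i+1}$; its Arnold class is $$A(w)=\sum_{i=0}^{k-1}\sigma_i\, e_{w_0}\cdots\widehat{e_{w_i}}\cdots e_{w_{k-1}}\in\Lambda^r(\Gamma),$$ where $\sigma_i=(-1)^i$ if $r$ is even, and, if $r$ is odd, $\sigma_i=1$ or $-1$ according to whether $w_i$ is traversed along or against its orientation (so $A(w)=\pm1$ if $w$ is a single loop). Let $I^r(\Gamma)$ be the ideal generated by the Arnold classes of all circuits of $\Gamma$, and $R^r(\Gamma)=\Lambda^r(\Gamma)/I^r(\Gamma)$,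 a graded commutative ring. Let $\alpha$ be an edge of $\Gamma$ that is not a loop. Let $\Gamma\smallsetminus\alpha$ be obtained from $\Gamma$ by deleting $\alpha$, and $\Gamma/\alpha$ by contracting $\alpha$, that is, by removing $\alpha$ and identifying its two vertices; the edges of both are the edges $\eta\neq\alpha$ of $\Gamma$, and $[\eta]$ denotes $\eta$ as an edge of $\Gamma/\alpha$. Let $\Lambda^r[e_\alpha]$ be the algebra above on the single generator $e_\alpha$, and let $\otimes$ be the tensor product over $\mathbb Z$ of graded commutative rings, with product $(a\otimes b)(a'\otimes b')=(-1)^{\deg b\,\deg a'}aa'\otimes bb'$. There are well-defined ring homomorphisms - $i_\alpha: R^r(\Gamma\smallsetminus\alpha)\to R^r(\Gamma)$, $e_\eta\mapsto e_\eta$; - $q_\alpha: R^r(\Gamma\smallsetminus\alpha)\to R^r(\Gamma/\alpha)$, $e_\eta\mapsto e_{[\eta]}$; - $\iota_\alpha: R^r(\Gamma/\alpha)\to R^r(\Gamma/\alpha)\otimes\Lambda^r[e_\alpha]$, $x\mapsto x\otimes 1$; - $\psi_\alpha: R^r(\Gamma)\to R^r(\Gamma/\alpha)\otimes\Lambda^r[e_\alpha]$,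 $e_\eta\mapsto e_{[\eta]}\otimes 1$ for $\eta\ne\alpha$, and $e_\alpha\mapsto 1\otimes e_\alpha$. **Theorem 1.** The square $$\begin{array}{ccc} R^r(\Gamma\smallsetminus\alpha) & \xrightarrow{\ q_\alpha\ } & R^r(\Gamma/\alpha)\\ {\scriptstyle i_\alpha}\downarrow & & \downarrow{\scriptstyle \iota_\alpha}\\ R^r(\Gamma) & \xrightarrow{\ \psi_\alpha\ } & R^r(\Gamma/\alpha)\otimes\Lambda^r[e_\alpha]\end{array}$$ is a pullback square of rings. The map $i_\alpha$ is injective, and the map $\psi_\alpha$ is surjective. -/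

import Mathlib

open CategoryTheory DirectSum
open scoped TensorProduct

noncomputable section

namespace GraphRing

/-! ### Graphs, deletion, contraction, circuits -/

/-- A graph with vertex set `V` and edge set `E`. Loops and multiple edges are allowed.
Every edge carries an orientation, from `src` to `tgt`; the rings below depend on it
only if the parameter `r` is odd. -/
structure OGraph (V : Type*) (E : Type*) where
  src : E → V
  tgt : E → V

variable {V V' : Type*} {E E' : Type*}

/-- The graph `Γ ∖ α`: same vertices, all the edges but `α`. -/
def OGraph.delete (Γ : OGraph V E) (α : E) : OGraph V {e : E // e ≠ α} where
  src e := Γ.src e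
  tgt e := Γ.tgt e

/-- The vertices of `Γ / α`: the two vertices incident to `α` are identified. -/
def OGraph.ContractVertex (Γ : OGraph V E) (α : E) : Type _ :=
  Quot (fun u v : V => u = Γ.src α ∧ v = Γ.tgt α)

/-- The graph `Γ / α`: the edge `α` is removed and its two vertices are identified. -/
def OGraph.contract (Γ : OGraph V E) (α : E) : OGraph (Γ.ContractVertex α) {e : E // e ≠ α} where
  src e := Quot.mk _ (Γ.src e)
  tgt e := Quot.mk _ (Γ.tgt e)

/-- A step of a walk is an edge together with a direction: `(e, true)` runs along `e` from
`src e` to `tgt e`, and `(e, false)` runs against the orientation of `e`. This is the vertex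
where the step starts. -/
def OGraph.start (Γ : OGraph V E) (d : E × Bool) : V := bif d.2 then Γ.src d.1 else Γ.tgt d.1

/-- The vertex where a step ends. -/
def OGraph.finish (Γ : OGraph V E) (d : E × Bool) : V := bif d.2 then Γ.tgt d.1 else Γ.src d.1

/-- `w` is a walk from `u` to `v`. -/
def OGraph.IsWalk (Γ : OGraph V E) : V → List (E × Bool) → V → Prop
  | u, [], v => u = v
  | u, d :: w, v => Γ.start d = u ∧ Γ.IsWalk (Γ.finish d) w v

/-- A circuit is a closed walk with at least one edge. -/
def OGraph.IsCircuit (Γ : OGraph V E) (w : List (E × Bool)) : Prop :=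
  w ≠ [] ∧ ∃ v, Γ.IsWalk v w v

/-! ### The graded commutative algebra on a set of generators of degree `r - 1` -/

/-- The sign `(-1) ^ (r - 1)`, which is the sign for exchanging two elements of degree `r - 1`. -/
def sgn (r : ℕ) : ℤ := (-1) ^ (r + 1)

/-- The defining relations: graded commutativity of generators of degree `r - 1`,
and the vanishing of the squares of the generators. -/
inductive LambdaRel (r : ℕ) (X : Type*) : FreeAlgebra ℤ X → FreeAlgebra ℤ X → Prop
  | comm (a b : X) : LambdaRel r X (FreeAlgebra.ι ℤ a * FreeAlgebra.ι ℤ b)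
      (sgn r • (FreeAlgebra.ι ℤ b * FreeAlgebra.ι ℤ a))
  | sq (a : X) : LambdaRel r X (FreeAlgebra.ι ℤ a * FreeAlgebra.ι ℤ a) 0

/-- The ring `Λ^r[X]`: the exterior algebra over `ℤ` on `X` if `r` is even, and
the polynomial ring `ℤ[X]` modulo the squares of the variables if `r` is odd. -/
def Lambda (r : ℕ) (X : Type*) : Type _ := RingQuot (LambdaRel r X)

instance (r : ℕ) (X : Type*) : Ring (Lambda r X) := inferInstanceAs (Ring (RingQuot _))

namespace Lambda

variable {r : ℕ} {X : Type*}

/-- The generator `e_x` of `Λ^r[X]`. -/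
def gen (r : ℕ) {X : Type*} (x : X) : Lambda r X :=
  RingQuot.mkRingHom (LambdaRel r X) (FreeAlgebra.ι ℤ x)

theorem gen_comm (a b : X) : gen r a * gen r b = sgn r • (gen r b * gen r a) := by
  have h := RingQuot.mkRingHom_rel (LambdaRel.comm (r := r) a b)
  rw [map_zsmul, map_mul, map_mul] at h
  exact h

theorem gen_sq (a : X) : gen r a * gen r a = 0 := by
  have h := RingQuot.mkRingHom_rel (LambdaRel.sq (r := r) a)
  rw [map_zero, map_mul] at h
  exact h

/-- The ring homomorphism out of `Λ^r[X]` with given values on the generators. -/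
def lift {T : Type*} [Ring T] (f : X → T) (hc : ∀ a b, f a * f b = sgn r • (f b * f a))
    (hs : ∀ a, f a * f a = 0) : Lambda r X →+* T :=
  RingQuot.lift ⟨(FreeAlgebra.lift ℤ f).toRingHom, by
    intro x y h
    cases h with
    | comm a b =>
      have := hc a b
      simpa using this
    | sq a => simpa using hs a⟩

@[simp] theorem lift_gen {T : Type*} [Ring T] (f : X → T)
    (hc : ∀ a b, f a * f b = sgn r • (f b * f a)) (hs : ∀ a, f a * f a = 0) (x : X) :
    lift f hc hs (gen r x) = f x := by
  have := RingQuot.lift_mkRingHom_apply (FreeAlgebra.lift ℤ f).toRingHom (r := LambdaRel r X)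
    (by
      intro x y h
      cases h with
      | comm a b =>
        have := hc a b
        simpa using this
      | sq a => simpa using hs a) (FreeAlgebra.ι ℤ x)
  refine Eq.trans this ?_
  simp

theorem induction {P : Lambda r X → Prop} (hint : ∀ n : ℤ, P n) (hgen : ∀ x, P (gen r x))
    (hadd : ∀ a b, P a → P b → P (a + b)) (hmul : ∀ a b, P a → P b → P (a * b))
    (a : Lambda r X) : P a := by
  obtain ⟨y, rfl⟩ := RingQuot.mkRingHom_surjective (LambdaRel r X) a
  induction y using FreeAlgebra.induction with
  | grade0 n =>
    have : RingQuot.mkRingHom (LambdaRel r X) (algebraMap ℤ _ n) = ((n : ℤ) : Lambda r X) := by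
      rw [eq_intCast (algebraMap ℤ (FreeAlgebra ℤ X)) n]
      exact map_intCast (RingQuot.mkRingHom (LambdaRel r X)) n
    rw [this]; exact hint n
  | grade1 x => exact hgen x
  | mul a b ha hb => rw [map_mul]; exact hmul _ _ ha hb
  | add a b ha hb => rw [map_add]; exact hadd _ _ ha hb

theorem hom_ext {T : Type*} [Ring T] {f g : Lambda r X →+* T}
    (h : ∀ x, f (gen r x) = g (gen r x)) : f = g := by
  ext a
  induction a using Lambda.induction with
  | hint n => simp
  | hgen x => exact h x
  | hadd a b ha hb => simp [ha, hb]
  | hmul a b ha hb => simp [ha, hb]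

/-- The ring homomorphism `Λ^r[X] → Λ^r[Y]` induced by a map of sets `X → Y`. -/
def map {Y : Type*} (f : X → Y) : Lambda r X →+* Lambda r Y :=
  lift (fun x => gen r (f x)) (fun _ _ => gen_comm _ _) (fun _ => gen_sq _)

@[simp] theorem map_gen {Y : Type*} (f : X → Y) (x : X) :
    map f (gen r x) = gen r (f x) := by simp [map]

end Lambda

/-! ### The Arnold classes, the Arnold ideal and the ring `R^r(Γ)` -/

/-- The product `e_w` of the generators of the edges of `w`, in order. -/
def edgeProd (r : ℕ) (w : List (E × Bool)) : Lambda r E :=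
  (w.map fun d => Lambda.gen r d.1).prod

/-- The sign of the `i`-th term of an Arnold class, for a step in the direction `b`:
`(-1) ^ i` if `r` is even, and `1` or `-1` according to the direction if `r` is odd. -/
def arnoldSign (r i : ℕ) (b : Bool) : ℤ :=
  if Even r then (-1) ^ i else (if b then 1 else -1)

/-- The Arnold class `A(w) = ∑ i, ± w_0 ⋯ ŵ_i ⋯ w_{k-1}`. Positions are counted from `0`, so
that a loop `w` (of length one, in the direction of its orientation) has `A(w) = 1`. -/
def arnold (r : ℕ) (w : List (E × Bool)) : Lambda r E :=
  ∑ i : Fin w.length, arnoldSign r i (w.get i).2 • edgeProd r (w.eraseIdx i)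

/-- The generalized Arnold ideal `I^r(Γ)`, generated by the Arnold classes of all circuits. -/
def arnoldIdeal (r : ℕ) (Γ : OGraph V E) : Ideal (Lambda r E) :=
  Ideal.span {x | ∃ w, Γ.IsCircuit w ∧ x = arnold r w}

theorem sgn_mul_sgn (r : ℕ) : sgn r * sgn r = 1 := by
  rcases neg_one_pow_eq_or ℤ (r + 1) with h | h <;> simp [sgn, h]

@[simp] theorem edgeProd_nil (r : ℕ) : edgeProd r ([] : List (E × Bool)) = 1 := rfl

@[simp] theorem edgeProd_cons (r : ℕ) (d : E × Bool) (w : List (E × Bool)) :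
    edgeProd r (d :: w) = Lambda.gen r d.1 * edgeProd r w := rfl

@[simp] theorem arnold_nil (r : ℕ) : arnold r ([] : List (E × Bool)) = 0 := by
  simp [arnold]

theorem arnold_cons (r : ℕ) (d : E × Bool) (w : List (E × Bool)) :
    arnold r (d :: w) =
      arnoldSign r 0 d.2 • edgeProd r w + sgn r • (Lambda.gen r d.1 * arnold r w) := by
  unfold arnold
  refine (Fin.sum_univ_succ (n := w.length) _).trans ?_
  simp only [List.length_cons, Fin.val_zero, List.get_eq_getElem, List.getElem_cons_zero,
    List.eraseIdx_zero, List.tail_cons, Fin.val_succ, List.getElem_cons_succ,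
    List.eraseIdx_cons_succ, edgeProd_cons, Finset.mul_sum, Finset.smul_sum, mul_smul_comm,
    smul_smul]
  congr 1
  refine Finset.sum_congr rfl fun i _ => ?_
  congr 1
  unfold arnoldSign sgn
  split_ifs with h
  · rw [(h.add_one).neg_one_pow]; ring
  all_goals
    rw [((Nat.not_even_iff_odd.mp h).add_one).neg_one_pow]; ring

theorem edgeProd_mul_gen (r : ℕ) (w : List (E × Bool)) (b : E) :
    edgeProd r w * Lambda.gen r b = sgn r ^ w.length • (Lambda.gen r b * edgeProd r w) := by
  induction w with
  | nil => simp
  | cons d w ih =>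
    rw [edgeProd_cons, mul_assoc, ih, mul_smul_comm, ← mul_assoc, Lambda.gen_comm d.1 b,
      smul_mul_assoc, smul_smul, mul_assoc, List.length_cons, pow_succ]

theorem arnold_mul_gen (r : ℕ) (w : List (E × Bool)) (b : E) :
    arnold r w * Lambda.gen r b = sgn r ^ (w.length + 1) • (Lambda.gen r b * arnold r w) := by
  induction w with
  | nil => simp
  | cons d w ih =>
    have h2 : sgn r ^ (w.length + 1 + 1) = sgn r ^ w.length := by
      rw [pow_succ, pow_succ, mul_assoc, sgn_mul_sgn, mul_one]
    rw [arnold_cons, add_mul, smul_mul_assoc, smul_mul_assoc, mul_assoc, ih, edgeProd_mul_gen,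
      mul_add, smul_add, List.length_cons, h2]
    congr 1
    · simp only [mul_smul_comm, smul_smul, mul_comm]
    · rw [mul_smul_comm, ← mul_assoc, Lambda.gen_comm d.1 b]
      simp only [smul_mul_assoc, mul_smul_comm, smul_smul, mul_assoc]
      congr 1
      rw [pow_succ, mul_assoc, sgn_mul_sgn, mul_one, mul_comm]

instance (r : ℕ) (Γ : OGraph V E) : (arnoldIdeal r Γ).IsTwoSided where
  mul_mem_of_left := by
    intro a b
    induction b using Lambda.induction generalizing a with
    | hint n =>
      intro h
      rw [← (Int.cast_commute n a).eq]
      exact Ideal.mul_mem_left _ _ h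
    | hgen x =>
      intro h
      unfold arnoldIdeal at h
      induction h using Submodule.span_induction with
      | mem y hy =>
        obtain ⟨w, hw, rfl⟩ := hy
        rw [arnold_mul_gen]
        have hm : arnold r w ∈ arnoldIdeal r Γ := Ideal.subset_span ⟨w, hw, rfl⟩
        exact zsmul_mem (Ideal.mul_mem_left _ _ hm) _
      | zero => simp
      | add y z _ _ hy hz => rw [add_mul]; exact add_mem hy hz
      | smul c y _ hy => rw [smul_eq_mul, mul_assoc]; exact Ideal.mul_mem_left _ _ hy
    | hadd b c hb hc => intro h; rw [mul_add]; exact add_mem (hb h) (hc h)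
    | hmul b c hb hc => intro h; rw [← mul_assoc]; exact hc (hb h)

/-- The ring `R^r(Γ) = Λ^r(Γ) / I^r(Γ)`. -/
def R (r : ℕ) (Γ : OGraph V E) : Type _ := Lambda r E ⧸ arnoldIdeal r Γ

instance (r : ℕ) (Γ : OGraph V E) : Ring (R r Γ) :=
  inferInstanceAs (Ring (Lambda r E ⧸ arnoldIdeal r Γ))

/-- The quotient map `Λ^r(Γ) → R^r(Γ)`. -/
def R.mk (r : ℕ) (Γ : OGraph V E) : Lambda r E →+* R r Γ := Ideal.Quotient.mk (arnoldIdeal r Γ)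

/-- The class of the generator of an edge in `R^r(Γ)`. -/
def R.gen (r : ℕ) (Γ : OGraph V E) (e : E) : R r Γ := R.mk r Γ (Lambda.gen r e)

theorem R.mk_surjective (r : ℕ) (Γ : OGraph V E) : Function.Surjective (R.mk r Γ) :=
  Ideal.Quotient.mk_surjective

theorem R.mk_arnold {r : ℕ} {Γ : OGraph V E} {w : List (E × Bool)} (hw : Γ.IsCircuit w) :
    R.mk r Γ (arnold r w) = 0 :=
  Ideal.Quotient.eq_zero_iff_mem.mpr (Ideal.subset_span ⟨w, hw, rfl⟩)

/-- A ring homomorphism out of `R^r(Γ)`, from one out of `Λ^r(Γ)` that kills the Arnold classes. -/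
def R.lift {r : ℕ} {Γ : OGraph V E} {T : Type*} [Ring T] (f : Lambda r E →+* T)
    (hf : ∀ w, Γ.IsCircuit w → f (arnold r w) = 0) : R r Γ →+* T :=
  Ideal.Quotient.lift (arnoldIdeal r Γ) f (by
    intro a ha
    unfold arnoldIdeal at ha
    induction ha using Submodule.span_induction with
    | mem y hy => obtain ⟨w, hw, rfl⟩ := hy; exact hf w hw
    | zero => simp
    | add y z _ _ hy hz => rw [map_add, hy, hz, add_zero]
    | smul c y _ hy => rw [smul_eq_mul, map_mul, hy, mul_zero])

@[simp] theorem R.lift_mk {r : ℕ} {Γ : OGraph V E} {T : Type*} [Ring T] (f : Lambda r E →+* T)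
    (hf : ∀ w, Γ.IsCircuit w → f (arnold r w) = 0) (x : Lambda r E) :
    R.lift (Γ := Γ) f hf (R.mk r Γ x) = f x := rfl

@[simp] theorem R.lift_gen {r : ℕ} {Γ : OGraph V E} {T : Type*} [Ring T] (f : Lambda r E →+* T)
    (hf : ∀ w, Γ.IsCircuit w → f (arnold r w) = 0) (e : E) :
    R.lift (Γ := Γ) f hf (R.gen r Γ e) = f (Lambda.gen r e) := rfl

/-! ### Maps induced by maps of graphs -/

theorem map_edgeProd (r : ℕ) (f : E → E') (w : List (E × Bool)) :
    Lambda.map f (edgeProd r w) = edgeProd r (w.map (Prod.map f id)) := by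
  induction w with
  | nil => simp
  | cons d w ih => simp [ih]

theorem map_arnold (r : ℕ) (f : E → E') (w : List (E × Bool)) :
    Lambda.map f (arnold r w) = arnold r (w.map (Prod.map f id)) := by
  induction w with
  | nil => simp
  | cons d w ih => simp [arnold_cons, ih, map_edgeProd]

theorem OGraph.IsWalk.map {Γ : OGraph V E} {Γ' : OGraph V' E'} {f : E → E'} {g : V → V'}
    (hs : ∀ e, Γ'.src (f e) = g (Γ.src e)) (ht : ∀ e, Γ'.tgt (f e) = g (Γ.tgt e))
    {w : List (E × Bool)} {u v : V} (h : Γ.IsWalk u w v) :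
    Γ'.IsWalk (g u) (w.map (Prod.map f id)) (g v) := by
  induction w generalizing u with
  | nil => exact congrArg g h
  | cons d w ih =>
    obtain ⟨e, b⟩ := d
    obtain ⟨rfl, h⟩ := h
    refine ⟨?_, ?_⟩
    · cases b <;> simp [start, hs, ht]
    · have := ih h
      cases b <;> simpa [finish, hs, ht] using this

/-- The map `R^r(Γ) → R^r(Γ')` induced by a map of graphs, given by a map `f` of edges and
a compatible map `g` of vertices. -/
def R.map (r : ℕ) {Γ : OGraph V E} {Γ' : OGraph V' E'} (f : E → E') (g : V → V')
    (hs : ∀ e, Γ'.src (f e) = g (Γ.src e)) (ht : ∀ e, Γ'.tgt (f e) = g (Γ.tgt e)) :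
    R r Γ →+* R r Γ' :=
  R.lift ((R.mk r Γ').comp (Lambda.map f)) (by
    rintro w ⟨hne, v, hw⟩
    rw [RingHom.comp_apply, map_arnold]
    exact R.mk_arnold ⟨by simpa using hne, g v, hw.map hs ht⟩)

/-- The map `i_α : R^r(Γ ∖ α) → R^r(Γ)` induced by the inclusion of graphs. -/
def deletionMap (r : ℕ) (Γ : OGraph V E) (α : E) : R r (Γ.delete α) →+* R r Γ :=
  R.map r Subtype.val id (fun _ => rfl) (fun _ => rfl)

/-- The map `p_α ∘ i_α : R^r(Γ ∖ α) → R^r(Γ / α)` induced by the map of graphs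
`Γ ∖ α ⊆ Γ → Γ / α`. -/
def deletionToContraction (r : ℕ) (Γ : OGraph V E) (α : E) :
    R r (Γ.delete α) →+* R r (Γ.contract α) :=
  R.map r id (Quot.mk _) (fun _ => rfl) (fun _ => rfl)

/-! ### Gradings -/

section WordGrading

variable {A : Type*} [Ring A] {X : Type*}

/-- If the ring `A` is generated by elements `g x` of degree `d`, then its part of degree `k` is
spanned by the products of `n` generators with `n * d = k`. -/
def wordGrading (d : ℤ) (g : X → A) (k : ℤ) : Submodule ℤ A :=
  Submodule.span ℤ {a | ∃ l : List X, (l.length : ℤ) * d = k ∧ (l.map g).prod = a}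

theorem prod_mem_wordGrading (d : ℤ) (g : X → A) (l : List X) :
    (l.map g).prod ∈ wordGrading d g (l.length * d) :=
  Submodule.subset_span ⟨l, rfl, rfl⟩

theorem gen_mem_wordGrading (d : ℤ) (g : X → A) (x : X) : g x ∈ wordGrading d g d := by
  have := prod_mem_wordGrading d g [x]
  simpa using this

instance (d : ℤ) (g : X → A) : SetLike.GradedMonoid (wordGrading d g) where
  one_mem := Submodule.subset_span ⟨[], by simp, by simp⟩
  mul_mem := by
    intro i j a b ha hb
    have h : a * b ∈ wordGrading d g i * wordGrading d g j := Submodule.mul_mem_mul ha hb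
    unfold wordGrading at h
    rw [Submodule.span_mul_span] at h
    refine Submodule.span_mono ?_ h
    rintro _ ⟨_, ⟨l, hl, rfl⟩, _, ⟨m, hm, rfl⟩, rfl⟩
    exact ⟨l ++ m, by simp [add_mul, hl, hm], by simp⟩

/-- The generator `g x` in the external direct sum of the homogeneous parts. -/
def wordGen (d : ℤ) (g : X → A) (x : X) : ⨁ k, wordGrading d g k :=
  DirectSum.of (fun k => wordGrading d g k) d ⟨g x, gen_mem_wordGrading d g x⟩

theorem of_eq_of_coe_eq {d : ℤ} {g : X → A} {i j : ℤ} (hij : i = j) {x : wordGrading d g i}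
    {y : wordGrading d g j} (h : (x : A) = y) :
    DirectSum.of (fun k => wordGrading d g k) i x = DirectSum.of _ j y := by
  subst hij
  rw [Subtype.ext h]

theorem prod_wordGen (d : ℤ) (g : X → A) (l : List X) :
    (l.map (wordGen d g)).prod =
      DirectSum.of (fun k => wordGrading d g k) _ ⟨_, prod_mem_wordGrading d g l⟩ := by
  induction l with
  | nil =>
    rw [List.map_nil, List.prod_nil, DirectSum.one_def]
    exact of_eq_of_coe_eq (by simp) rfl
  | cons x l ih =>
    rw [List.map_cons, List.prod_cons, ih, wordGen, DirectSum.of_mul_of]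
    exact of_eq_of_coe_eq (by simp; ring) rfl

/-- A ring homomorphism to the direct sum of the homogeneous parts which fixes the generators
shows that these parts do form a grading. -/
@[reducible] def wordGradedRing (d : ℤ) (g : X → A) (f : A →+* ⨁ k, wordGrading d g k)
    (hf : ∀ x, f (g x) = wordGen d g x)
    (hid : ∀ h : A →+* A, (∀ x, h (g x) = g x) → h = RingHom.id A) :
    GradedAlgebra (wordGrading d g) :=
  GradedAlgebra.ofAlgHom _ f.toIntAlgHom
    (by
      have h := hid ((DirectSum.coeAlgHom (wordGrading d g)).toRingHom.comp f) (by
        intro x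
        simp only [AlgHom.toRingHom_eq_coe, RingHom.coe_comp, RingHom.coe_coe,
          Function.comp_apply, hf, wordGen]
        exact DirectSum.coeAlgHom_of _ _ _)
      ext x
      exact RingHom.congr_fun h x)
    (by
      rintro k ⟨x, hx⟩
      have key : ∀ y (hy : y ∈ wordGrading d g k),
          f y = DirectSum.of (fun k => wordGrading d g k) k ⟨y, hy⟩ := by
        intro y hy
        have hy' := hy
        unfold wordGrading at hy'
        induction hy' using Submodule.span_induction with
        | mem y hm =>
          obtain ⟨l, hl, rfl⟩ := hm
          rw [map_list_prod, List.map_map]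
          have : (f ∘ g) = wordGen d g := funext hf
          rw [this, prod_wordGen]
          exact of_eq_of_coe_eq hl rfl
        | zero =>
          rw [map_zero]
          exact (map_zero (DirectSum.of (fun k => wordGrading d g k) k)).symm
        | add a b ha hb iha ihb =>
          rw [map_add, iha ha, ihb hb, ← map_add]
          rfl
        | smul n a ha iha =>
          rw [map_zsmul, iha ha, ← map_zsmul]
          rfl
      exact key x hx)

end WordGrading

/-- The grading of `Λ^r[X]`, with the generators in degree `r - 1`. -/
abbrev Lambda.grading (r : ℕ) (X : Type*) : ℤ → Submodule ℤ (Lambda r X) :=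
  wordGrading ((r : ℤ) - 1) (Lambda.gen r)

/-- The grading of `R^r(Γ)`, with the generators in degree `r - 1`. -/
abbrev R.grading (r : ℕ) (Γ : OGraph V E) : ℤ → Submodule ℤ (R r Γ) :=
  wordGrading ((r : ℤ) - 1) (R.gen r Γ)

theorem wordGen_comm {A : Type*} [Ring A] {X : Type*} (r : ℕ) (d : ℤ) (g : X → A)
    (hg : ∀ a b, g a * g b = sgn r • (g b * g a)) (a b : X) :
    wordGen d g a * wordGen d g b = sgn r • (wordGen d g b * wordGen d g a) := by
  simp only [wordGen, DirectSum.of_mul_of, ← map_zsmul]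
  exact of_eq_of_coe_eq rfl (hg a b)

theorem wordGen_sq {A : Type*} [Ring A] {X : Type*} (d : ℤ) (g : X → A)
    (hg : ∀ a, g a * g a = 0) (a : X) : wordGen d g a * wordGen d g a = 0 := by
  rw [wordGen, DirectSum.of_mul_of, ← map_zero (DirectSum.of (fun k => wordGrading d g k) (d + d))]
  exact of_eq_of_coe_eq rfl (hg a)

instance (r : ℕ) (X : Type*) : GradedAlgebra (Lambda.grading r X) :=
  wordGradedRing _ _
    (Lambda.lift (wordGen _ _) (wordGen_comm r _ _ Lambda.gen_comm) (wordGen_sq _ _ Lambda.gen_sq))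
    (fun x => Lambda.lift_gen _ _ _ x) (fun h hh => Lambda.hom_ext hh)

theorem R.gen_comm (r : ℕ) (Γ : OGraph V E) (a b : E) :
    R.gen r Γ a * R.gen r Γ b = sgn r • (R.gen r Γ b * R.gen r Γ a) := by
  simp only [R.gen, ← map_mul, ← map_zsmul, Lambda.gen_comm a b]

theorem R.gen_sq (r : ℕ) (Γ : OGraph V E) (a : E) : R.gen r Γ a * R.gen r Γ a = 0 := by
  simp only [R.gen, ← map_mul, Lambda.gen_sq a, map_zero]

theorem R.mk_edgeProd (r : ℕ) (Γ : OGraph V E) (w : List (E × Bool)) :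
    R.mk r Γ (edgeProd r w) = ((w.map Prod.fst).map (R.gen r Γ)).prod := by
  induction w with
  | nil => simp
  | cons d w ih => simp [ih, R.gen]

theorem mk_arnold_homogeneous (r : ℕ) (Γ : OGraph V E) (w : List (E × Bool)) :
    ∃ x : R.grading r Γ (((w.length : ℤ) - 1) * ((r : ℤ) - 1)), (x : R r Γ) = R.mk r Γ (arnold r w) ∧
      Lambda.lift (wordGen ((r : ℤ) - 1) (R.gen r Γ)) (wordGen_comm r _ _ (R.gen_comm r Γ))
        (wordGen_sq _ _ (R.gen_sq r Γ)) (arnold r w) =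
        DirectSum.of (fun k => R.grading r Γ k) _ x := by
  set F := Lambda.lift (wordGen ((r : ℤ) - 1) (R.gen r Γ)) (wordGen_comm r _ _ (R.gen_comm r Γ))
        (wordGen_sq _ _ (R.gen_sq r Γ)) with hF
  have hprod : ∀ w : List (E × Bool), F (edgeProd r w) =
      ((w.map Prod.fst).map (wordGen ((r : ℤ) - 1) (R.gen r Γ))).prod := by
    intro w
    induction w with
    | nil => simp
    | cons d w ih =>
      rw [edgeProd_cons, map_mul, ih, hF, Lambda.lift_gen]
      rfl
  induction w with
  | nil => exact ⟨0, by simp, by simp⟩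
  | cons d w ih =>
    obtain ⟨x, hx, hx'⟩ := ih
    have h1 : R.mk r Γ (edgeProd r w) ∈
        R.grading r Γ ((((d :: w).length : ℤ) - 1) * ((r : ℤ) - 1)) := by
      rw [R.mk_edgeProd]
      have := prod_mem_wordGrading ((r : ℤ) - 1) (R.gen r Γ) (w.map Prod.fst)
      simpa using this
    have hdeg : ((r : ℤ) - 1) + ((w.length : ℤ) - 1) * ((r : ℤ) - 1) =
        (((d :: w).length : ℤ) - 1) * ((r : ℤ) - 1) := by
      simp; ring
    have h2 : R.gen r Γ d.1 * (x : R r Γ) ∈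
        R.grading r Γ ((((d :: w).length : ℤ) - 1) * ((r : ℤ) - 1)) := by
      rw [← hdeg]
      exact SetLike.GradedMul.mul_mem (gen_mem_wordGrading _ _ _) x.2
    refine ⟨arnoldSign r 0 d.2 • ⟨_, h1⟩ + sgn r • ⟨_, h2⟩, ?_, ?_⟩
    · simp [arnold_cons, hx, R.gen]
    · rw [arnold_cons, map_add, map_zsmul, map_zsmul, map_mul, hx', hprod, prod_wordGen,
        hF, Lambda.lift_gen, wordGen, DirectSum.of_mul_of, map_add, map_zsmul, map_zsmul]
      congr 2
      · exact of_eq_of_coe_eq (by simp) (R.mk_edgeProd r Γ w).symm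
      · exact of_eq_of_coe_eq hdeg rfl

instance (r : ℕ) (Γ : OGraph V E) : GradedAlgebra (R.grading r Γ) :=
  wordGradedRing _ _
    (R.lift (Lambda.lift (wordGen _ _) (wordGen_comm r _ _ (R.gen_comm r Γ))
        (wordGen_sq _ _ (R.gen_sq r Γ))) (by
      intro w hw
      obtain ⟨x, hx, hx'⟩ := mk_arnold_homogeneous r Γ w
      rw [hx']
      rw [R.mk_arnold hw] at hx
      rw [show x = 0 from Subtype.ext hx, map_zero]))
    (fun x => by rw [R.lift_gen, Lambda.lift_gen])
    (fun _ hh => by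
      have := Lambda.hom_ext (f := RingHom.comp _ (R.mk r Γ)) (g := R.mk r Γ) hh
      ext y
      obtain ⟨z, rfl⟩ := R.mk_surjective r Γ y
      exact RingHom.congr_fun this z)

/-! ### The graded tensor product with `Λ^r[e_α]` and the map `ψ_α` -/

/-- The ring `R^r(Γ) ⊗ Λ^r[e]`, where `Λ^r[e]` is the algebra on a single generator `e` of degree
`r - 1`, and the tensor product is that of graded commutative rings: its product is
`(a ⊗ b) (a' ⊗ b') = (-1) ^ (deg b * deg a') • (a a' ⊗ b b')`. -/
abbrev RTensor (r : ℕ) (Γ : OGraph V E) : Type _ :=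
  R.grading r Γ ᵍ⊗[ℤ] Lambda.grading r Unit

/-- The map `ι : R^r(Γ) → R^r(Γ) ⊗ Λ^r[e]`, `x ↦ x ⊗ 1`. -/
def tensorInl (r : ℕ) (Γ : OGraph V E) : R r Γ →+* RTensor r Γ :=
  (GradedTensorProduct.includeLeft (R.grading r Γ) (Lambda.grading r Unit)).toRingHom

/-- The map `Λ^r[e] → R^r(Γ) ⊗ Λ^r[e]`, `y ↦ 1 ⊗ y`. -/
def tensorInr (r : ℕ) (Γ : OGraph V E) : Lambda r Unit →+* RTensor r Γ :=
  (GradedTensorProduct.includeRight (R.grading r Γ) (Lambda.grading r Unit)).toRingHom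

theorem neg_one_uzpow_eq_sgn (r : ℕ) :
    (((-1 : ℤˣ) ^ (((r : ℤ) - 1) * ((r : ℤ) - 1)) : ℤˣ) : ℤ) = sgn r := by
  have h : ∀ n : ℤ, (-1 : ℤˣ) ^ n = if Even n then 1 else -1 := by
    intro n
    split_ifs with hn
    · exact hn.neg_one_zpow
    · exact (Int.not_even_iff_odd.mp hn).neg_one_zpow
  rw [h]
  unfold sgn
  rcases Nat.even_or_odd r with hr | hr
  · have h1 : ¬ Even (((r : ℤ) - 1) * ((r : ℤ) - 1)) := by
      rw [Int.even_mul, or_self, Int.even_sub_one, not_not]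
      exact_mod_cast hr
    rw [if_neg h1, hr.add_one.neg_one_pow]
    rfl
  · have h1 : Even (((r : ℤ) - 1) * ((r : ℤ) - 1)) := by
      rw [Int.even_mul, or_self, Int.even_sub_one, Int.not_even_iff_odd]
      exact_mod_cast hr
    rw [if_pos h1, hr.add_one.neg_one_pow]
    rfl

theorem tensorInr_mul_tensorInl (r : ℕ) (Γ : OGraph V E) (e : E) (u : Unit) :
    tensorInr r Γ (Lambda.gen r u) * tensorInl r Γ (R.gen r Γ e) =
      sgn r • (tensorInl r Γ (R.gen r Γ e) * tensorInr r Γ (Lambda.gen r u)) := by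
  have h1 := GradedTensorProduct.tmul_coe_mul_coe_tmul (R.grading r Γ) (Lambda.grading r Unit)
    (1 : R r Γ) ⟨Lambda.gen r u, gen_mem_wordGrading ((r : ℤ) - 1) (Lambda.gen r) u⟩
    ⟨R.gen r Γ e, gen_mem_wordGrading ((r : ℤ) - 1) (R.gen r Γ) e⟩ (1 : Lambda r Unit)
  have h2 := GradedTensorProduct.tmul_one_mul_one_tmul (R.grading r Γ) (Lambda.grading r Unit)
    (R.gen r Γ e) (Lambda.gen r u)
  rw [Units.smul_def, neg_one_uzpow_eq_sgn, one_mul, mul_one] at h1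
  exact h1.trans (congrArg (sgn r • ·) h2.symm)

theorem tensorInl_mul_tensorInr (r : ℕ) (Γ : OGraph V E) (e : E) (u : Unit) :
    tensorInl r Γ (R.gen r Γ e) * tensorInr r Γ (Lambda.gen r u) =
      sgn r • (tensorInr r Γ (Lambda.gen r u) * tensorInl r Γ (R.gen r Γ e)) := by
  rw [tensorInr_mul_tensorInl, smul_smul, sgn_mul_sgn, one_smul]

open Classical in
/-- The images of the generators under `ψ_α`: `e_η ↦ e_η ⊗ 1` if `η ≠ α` and `e_α ↦ 1 ⊗ e_α`. -/
def psiGen (r : ℕ) (Γ : OGraph V E) (α : E) (e : E) : RTensor r (Γ.contract α) :=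
  if h : e = α then tensorInr r (Γ.contract α) (Lambda.gen r ())
  else tensorInl r (Γ.contract α) (R.gen r (Γ.contract α) ⟨e, h⟩)

/-- The map `Λ^r(Γ) → R^r(Γ / α) ⊗ Λ^r[e_α]` that induces `ψ_α`. -/
def psiLambda (r : ℕ) (Γ : OGraph V E) (α : E) : Lambda r E →+* RTensor r (Γ.contract α) :=
  Lambda.lift (psiGen r Γ α)
    (by
      intro a b
      unfold psiGen
      split_ifs with ha hb hb
      · rw [← map_mul, ← map_zsmul, ← Lambda.gen_comm]
      · exact tensorInr_mul_tensorInl _ _ _ _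
      · exact tensorInl_mul_tensorInr _ _ _ _
      · rw [← map_mul, ← map_mul, ← map_zsmul, ← R.gen_comm])
    (by
      intro a
      unfold psiGen
      split_ifs with ha
      · rw [← map_mul, Lambda.gen_sq, map_zero]
      · rw [← map_mul, R.gen_sq, map_zero])

open Classical in
/-- The steps of `w` along the edges different from `α`. -/
def dropEdge (α : E) (w : List (E × Bool)) : List ({e : E // e ≠ α} × Bool) :=
  w.filterMap fun d => if h : d.1 = α then none else some (⟨d.1, h⟩, d.2)

theorem isWalk_dropEdge {Γ : OGraph V E} (α : E) {w : List (E × Bool)} {u v : V}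
    (h : Γ.IsWalk u w v) :
    (Γ.contract α).IsWalk (Quot.mk _ u) (dropEdge α w) (Quot.mk _ v) := by
  induction w generalizing u with
  | nil => exact congrArg _ h
  | cons d w ih =>
    obtain ⟨e, b⟩ := d
    obtain ⟨rfl, h⟩ := h
    have ih := ih h
    by_cases he : e = α
    · subst he
      have hq : (Quot.mk _ (Γ.src e) : Γ.ContractVertex e) = Quot.mk _ (Γ.tgt e) :=
        Quot.sound ⟨rfl, rfl⟩
      have : dropEdge e ((e, b) :: w) = dropEdge e w := by simp [dropEdge]
      rw [this]
      cases b
      · simpa [OGraph.start, OGraph.finish, hq] using ih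
      · simpa [OGraph.start, OGraph.finish, hq] using ih
    · have : dropEdge α ((e, b) :: w) = (⟨e, he⟩, b) :: dropEdge α w := by simp [dropEdge, he]
      rw [this]
      refine ⟨?_, ?_⟩
      · cases b <;> rfl
      · cases b <;> exact ih

/-- The ring endomorphism of `Λ^r[X]` that multiplies each generator by `(-1) ^ (r - 1)`. -/
def Lambda.twist (r : ℕ) (X : Type*) : Lambda r X →+* Lambda r X :=
  Lambda.lift (fun x => sgn r • Lambda.gen r x)
    (by
      intro a b
      simp only [smul_mul_assoc, mul_smul_comm]
      rw [Lambda.gen_comm a b])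
    (by
      intro a
      simp only [smul_mul_assoc, mul_smul_comm]
      rw [Lambda.gen_sq a, smul_zero, smul_zero])

theorem Lambda.twist_gen (r : ℕ) {X : Type*} (x : X) :
    Lambda.twist r X (Lambda.gen r x) = sgn r • Lambda.gen r x := Lambda.lift_gen _ _ _ x

theorem Lambda.twist_twist (r : ℕ) {X : Type*} (y : Lambda r X) :
    Lambda.twist r X (Lambda.twist r X y) = y := by
  have : (Lambda.twist r X).comp (Lambda.twist r X) = RingHom.id _ := by
    apply Lambda.hom_ext
    intro x
    rw [RingHom.comp_apply, twist_gen, map_zsmul, twist_gen, smul_smul, sgn_mul_sgn, one_smul]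
    rfl
  exact RingHom.congr_fun this y

theorem tensorInl_mul_tensorInr_twist (r : ℕ) (Γ : OGraph V E) (e : E) (y : Lambda r Unit) :
    tensorInl r Γ (R.gen r Γ e) * tensorInr r Γ y =
      tensorInr r Γ (Lambda.twist r Unit y) * tensorInl r Γ (R.gen r Γ e) := by
  induction y using Lambda.induction with
  | hint n => simp only [map_intCast]; exact (Int.cast_commute n _).eq.symm
  | hgen x => rw [tensorInl_mul_tensorInr, Lambda.twist_gen, map_zsmul, smul_mul_assoc]
  | hadd a b ha hb => simp only [map_add, mul_add, add_mul, ha, hb]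
  | hmul a b ha hb => rw [map_mul, ← mul_assoc, ha, mul_assoc, hb, ← mul_assoc, map_mul, map_mul]

theorem mul_zsmul_right {T : Type*} [Ring T] (n : ℤ) (a b : T) : a * (n • b) = n • (a * b) :=
  mul_smul_comm n a b

theorem exists_psiLambda_eq (r : ℕ) (Γ : OGraph V E) (α : E) (w : List (E × Bool)) :
    ∃ p c : Lambda r Unit,
      psiLambda r Γ α (edgeProd r w) = tensorInr r (Γ.contract α) p *
        tensorInl r (Γ.contract α) (R.mk r (Γ.contract α) (edgeProd r (dropEdge α w))) ∧
      psiLambda r Γ α (arnold r w) =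
        tensorInr r (Γ.contract α) (Lambda.twist r Unit p) *
          tensorInl r (Γ.contract α) (R.mk r (Γ.contract α) (arnold r (dropEdge α w))) +
        tensorInr r (Γ.contract α) c *
          tensorInl r (Γ.contract α) (R.mk r (Γ.contract α) (edgeProd r (dropEdge α w))) := by
  induction w with
  | nil => exact ⟨1, 0, by simp [dropEdge], by simp [dropEdge]⟩
  | cons d w ih =>
    obtain ⟨e, b⟩ := d
    obtain ⟨p, c, h1, h2⟩ := ih
    by_cases he : e = α
    · subst he
      have hd : dropEdge e ((e, b) :: w) = dropEdge e w := by simp [dropEdge]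
      have hg : psiLambda r Γ e (Lambda.gen r e) =
          tensorInr r (Γ.contract e) (Lambda.gen r ()) := by simp [psiLambda, psiGen]
      refine ⟨Lambda.gen r () * p, arnoldSign r 0 b • p + sgn r • (Lambda.gen r () * c), ?_, ?_⟩
      · rw [hd, edgeProd_cons, map_mul, h1, hg, map_mul, mul_assoc]
      · rw [hd, arnold_cons, map_add, map_zsmul, map_zsmul, map_mul, h1, h2, hg]
        simp only [map_mul, map_add, map_zsmul, Lambda.twist_gen, add_mul, mul_add, smul_mul_assoc,
          smul_add, mul_assoc]
        abel
    · have hd : dropEdge α ((e, b) :: w) = (⟨e, he⟩, b) :: dropEdge α w := by simp [dropEdge, he]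
      have hg : psiLambda r Γ α (Lambda.gen r e) =
          tensorInl r (Γ.contract α) (R.gen r (Γ.contract α) ⟨e, he⟩) := by
        simp [psiLambda, psiGen, he]
      refine ⟨Lambda.twist r Unit p, sgn r • Lambda.twist r Unit c, ?_, ?_⟩
      · rw [hd, edgeProd_cons, edgeProd_cons, map_mul, h1, hg, ← mul_assoc,
          tensorInl_mul_tensorInr_twist, mul_assoc, map_mul, map_mul]
        rfl
      · rw [hd, arnold_cons, arnold_cons, edgeProd_cons, map_add, map_zsmul, map_zsmul, map_mul,
          h1, h2, hg, mul_add, ← mul_assoc, ← mul_assoc, tensorInl_mul_tensorInr_twist,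
          tensorInl_mul_tensorInr_twist, Lambda.twist_twist]
        simp only [map_mul, map_add, map_zsmul, mul_add, smul_mul_assoc, mul_zsmul_right,
          smul_add, mul_assoc, R.gen, add_assoc]

theorem mk_edgeProd_eq_zero {r : ℕ} {Γ : OGraph V E} {w : List (E × Bool)}
    (hw : Γ.IsCircuit w) : R.mk r Γ (edgeProd r w) = 0 := by
  obtain ⟨d, w, rfl⟩ := List.exists_cons_of_ne_nil hw.1
  have h : Lambda.gen r d.1 * arnold r (d :: w) = arnoldSign r 0 d.2 • edgeProd r (d :: w) := by
    rw [arnold_cons, mul_add, mul_smul_comm, mul_smul_comm, ← mul_assoc, Lambda.gen_sq, zero_mul,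
      smul_zero, add_zero, edgeProd_cons]
  have h' := congrArg (R.mk r Γ) h
  rw [map_mul, R.mk_arnold hw, mul_zero, map_zsmul] at h'
  have hs : arnoldSign r 0 d.2 * arnoldSign r 0 d.2 = 1 := by
    unfold arnoldSign
    split_ifs <;> simp
  rw [← one_smul ℤ (R.mk r Γ (edgeProd r (d :: w))), ← hs, mul_smul, ← h', smul_zero]

theorem arnold_eq_zero_of_dropEdge_eq_nil {r : ℕ} {Γ : OGraph V E} {α : E}
    (hα : Γ.src α ≠ Γ.tgt α) {w : List (E × Bool)} {v : V} (hw : Γ.IsWalk v w v)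
    (h : dropEdge α w = []) : arnold r w = 0 := by
  have hall : ∀ d ∈ w, d.1 = α := by
    intro d hd
    by_contra hne
    have : (⟨⟨d.1, hne⟩, d.2⟩ : {e : E // e ≠ α} × Bool) ∈ dropEdge α w :=
      List.mem_filterMap.mpr ⟨d, hd, by simp [hne]⟩
    rw [h] at this
    exact List.not_mem_nil this
  match w, hw, hall with
  | [], _, _ => simp
  | [(a, b)], hw, hall =>
    obtain rfl : a = α := hall (a, b) (by simp)
    obtain ⟨h1, h2⟩ := hw
    cases b
    · exact absurd (h2.trans h1.symm) hα
    · exact absurd (h1.trans h2.symm) hα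
  | [(a, b), (a', b')], hw, hall =>
    obtain rfl : a = α := hall (a, b) (by simp)
    obtain rfl : a' = a := hall (a', b') (by simp)
    obtain ⟨h1, h2, h3⟩ := hw
    have hb : b' = !b := by
      cases b <;> cases b' <;> simp_all [OGraph.start, OGraph.finish]
    subst hb
    simp only [arnold_cons, arnold_nil, edgeProd_cons, edgeProd_nil, mul_one, mul_zero, smul_zero,
      add_zero, mul_smul_comm, smul_smul, ← add_smul]
    have : arnoldSign r 0 b + sgn r * arnoldSign r 0 (!b) = 0 := by
      unfold arnoldSign sgn
      split_ifs with hr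
      · rw [hr.add_one.neg_one_pow]; simp
      all_goals
        rw [(Nat.not_even_iff_odd.mp hr).add_one.neg_one_pow]; simp_all
    rw [this, zero_smul]
  | (a, b) :: (a', b') :: (a'', b'') :: w, _, hall =>
    obtain rfl : a = α := hall (a, b) (by simp)
    obtain rfl : a' = a := hall (a', b') (by simp)
    obtain rfl : a'' = a' := hall (a'', b'') (by simp)
    simp only [arnold_cons, edgeProd_cons, mul_add, mul_smul_comm, ← mul_assoc, Lambda.gen_sq,
      zero_mul, smul_zero, add_zero]

/-- The map `ψ_α : R^r(Γ) → R^r(Γ / α) ⊗ Λ^r[e_α]`, for an edge `α` that is not a loop. On the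
generators it is given by `e_η ↦ e_η ⊗ 1` if `η ≠ α`, and `e_α ↦ 1 ⊗ e_α`. -/
def psi (r : ℕ) (Γ : OGraph V E) (α : E) (hα : Γ.src α ≠ Γ.tgt α) :
    R r Γ →+* RTensor r (Γ.contract α) :=
  R.lift (psiLambda r Γ α) (by
    rintro w ⟨-, v, hw⟩
    by_cases h : dropEdge α w = []
    · rw [arnold_eq_zero_of_dropEdge_eq_nil hα hw h, map_zero]
    · have hc : (Γ.contract α).IsCircuit (dropEdge α w) := ⟨h, _, isWalk_dropEdge α hw⟩
      obtain ⟨p, c, -, h2⟩ := exists_psiLambda_eq r Γ α w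
      rw [h2, R.mk_arnold hc, mk_edgeProd_eq_zero hc]
      simp)

end GraphRing

end

/-! The core is the exact sequence `0 → R(Γ ∖ α) → R(Γ) → R(Γ / α) → 0` whose second map is, up to
signs, the residue at `α`. Every `x` in `Λ^r[E]` has the form `a + e_α b` with `a`, `b` free of
`e_α`, and `b` is its residue. Relations of `Γ` and `Γ / α` correspond in two ways. The residue of a
relation of `Γ` is a relation of `Γ / α` (`residue_mem_circuitIdeal`), since dropping the steps
along `α` turns circuits into circuits. Conversely, each relation `b` of `Γ / α` extends to a
relation `a + e_α b` of `Γ` (`circuitIdeal_contractAll_le`), since a circuit of `Γ / α` can be cut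
at the contracted vertex into walks of `Γ` that `α` closes up.

Injectivity of `i_α` means that a relation free of `e_α` already follows from circuits avoiding `α`.
For a finite set `S` of other edges this is shown by induction on its size, for all graphs at once.
A loop in `S` makes the ideal everything, and parallel edges are substituted for each other.
Otherwise `α` remains a non-loop in `Γ / β` for `β ∈ S`, so by induction the residues of `x` at all
`β ∈ S` are relations of `Γ / β` not using `α`. These residues determine `x`, modulo circuits in
`S`, up to the part without generators from `S` (`sub_kill_mem_circuitIdeal`), and that part
vanishes. A relation uses finitely many edges, so arbitrary graphs follow (`deletionInjective`).

For the pullback, if `ψ_α(x) = y ⊗ 1`, comparing coefficients of `e_α` makes the residue of `x` zero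
in `R(Γ / α)`. Subtracting a relation with that residue leaves a representative of `x` free of `e_α`
(`exists_deletionMap_eq`).

To stay inside one algebra `Λ^r[E]`, contraction keeps `α` as a loop, and an edge set `S` prescribes
which circuits are allowed. Ideals are left ideals, so moving factors to the left introduces
`twist`. -/

noncomputable section

namespace GraphRing

universe u

/-! ### Setting generators to zero, and residues, in `Λ^r[X]`. -/

namespace Lambda

variable {r : ℕ} {X Y : Type*}

theorem mul_gen (y : Lambda r X) (b : X) : y * gen r b = gen r b * twist r X y := by
  induction y using Lambda.induction with
  | hint n => rw [map_intCast]; exact (Int.cast_commute n _).eq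
  | hgen x => rw [twist_gen, gen_comm, mul_smul_comm]
  | hadd a b ha hb => rw [map_add, add_mul, mul_add, ha, hb]
  | hmul a b ha hb => rw [map_mul, mul_assoc, hb, ← mul_assoc, ha, mul_assoc]

/-- The ring homomorphism `Λ^r[X] → Λ^r[Y]` with `e_x ↦ c x • e_{g x}`. -/
def scaleMap (r : ℕ) (c : X → ℤ) (g : X → Y) : Lambda r X →+* Lambda r Y :=
  lift (fun x => c x • gen r (g x))
    (by
      intro a b
      simp only [smul_mul_assoc, mul_smul_comm]
      rw [gen_comm (g a) (g b)]
      simp only [smul_smul]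
      congr 1
      ring)
    (by
      intro a
      simp only [smul_mul_assoc, mul_smul_comm]
      rw [gen_sq, smul_zero, smul_zero])

theorem scaleMap_gen (c : X → ℤ) (g : X → Y) (x : X) :
    scaleMap r c g (gen r x) = c x • gen r (g x) := lift_gen _ _ _ x

open Classical in
/-- The endomorphism of `Λ^r[X]` that sends the generators `e_x` with `x ∈ S` to zero
and fixes the others. -/
def kill (r : ℕ) (S : Set X) : Lambda r X →+* Lambda r X :=
  scaleMap r (fun x => if x ∈ S then 0 else 1) id

theorem kill_gen_of_mem {S : Set X} {x : X} (hx : x ∈ S) : kill r S (gen r x) = 0 := by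
  simp [kill, scaleMap_gen, hx]

theorem kill_gen_of_notMem {S : Set X} {x : X} (hx : x ∉ S) :
    kill r S (gen r x) = gen r x := by
  simp [kill, scaleMap_gen, hx]

theorem kill_kill (S T : Set X) (x : Lambda r X) :
    kill r S (kill r T x) = kill r (S ∪ T) x := by
  have : (kill r S).comp (kill r T) = kill r (S ∪ T) := by
    apply hom_ext
    intro x
    by_cases hT : x ∈ T
    · simp [kill_gen_of_mem, hT]
    · by_cases hS : x ∈ S <;> simp [kill_gen_of_mem, kill_gen_of_notMem, hS, hT]
  exact RingHom.congr_fun this x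

theorem kill_self (S : Set X) (x : Lambda r X) : kill r S (kill r S x) = kill r S x := by
  rw [kill_kill, Set.union_self]

theorem kill_twist (S : Set X) (x : Lambda r X) :
    kill r S (twist r X x) = twist r X (kill r S x) := by
  have : (kill r S).comp (twist r X) = (twist r X).comp (kill r S) := by
    apply hom_ext
    intro x
    by_cases hS : x ∈ S <;> simp [kill_gen_of_mem, kill_gen_of_notMem, hS, twist_gen]
  exact RingHom.congr_fun this x

/-- The ring homomorphism to upper triangular matrices whose off-diagonal entry is the residue. -/
def residueHom (r : ℕ) (β : X) : Lambda r X →+* Matrix (Fin 2) (Fin 2) (Lambda r X) :=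
  open Classical in
  lift (fun x => if x = β then !![0, 1; 0, 0] else !![sgn r • gen r x, 0; 0, gen r x])
    (by
      intro a b
      by_cases ha : a = β <;> by_cases hb : b = β
      · rw [if_pos ha, if_pos hb]
        ext i j
        fin_cases i <;> fin_cases j <;> simp
      · rw [if_pos ha, if_neg hb]
        ext i j
        fin_cases i <;> fin_cases j <;> simp [-zsmul_eq_mul, smul_smul, sgn_mul_sgn]
      · rw [if_neg ha, if_pos hb]
        ext i j
        fin_cases i <;> fin_cases j <;> simp
      · rw [if_neg ha, if_neg hb]
        ext i j
        fin_cases i <;> fin_cases j <;>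
          simp [-zsmul_eq_mul, gen_comm a b])
    (by
      intro a
      by_cases ha : a = β
      · rw [if_pos ha]
        ext i j
        fin_cases i <;> fin_cases j <;> simp
      · rw [if_neg ha]
        ext i j
        fin_cases i <;> fin_cases j <;>
          simp [-zsmul_eq_mul, gen_sq])

theorem residueHom_gen_self (β : X) : residueHom r β (gen r β) = !![0, 1; 0, 0] := by
  simp [residueHom]

theorem residueHom_gen_of_ne {β x : X} (h : x ≠ β) :
    residueHom r β (gen r x) = !![sgn r • gen r x, 0; 0, gen r x] := by
  simp [residueHom, h]

/-- The residue at `β`, that is, the coefficient `b` in `x = a + e_β b` where `a` and `b` do not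
involve `e_β`. -/
def residue (r : ℕ) (β : X) : Lambda r X →+ Lambda r X where
  toFun x := residueHom r β x 0 1
  map_zero' := by simp
  map_add' := by simp

/-- Both diagonal entries set `e_β` to zero. The upper one also twists, so the corner entry of a
product obeys the sign rule for moving `e_β` to the front. -/
theorem residueHom_entries (β : X) (x : Lambda r X) :
    residueHom r β x 0 0 = twist r X (kill r {β} x) ∧ residueHom r β x 1 0 = 0 ∧
      residueHom r β x 1 1 = kill r {β} x := by
  induction x using Lambda.induction with
  | hint n => simp [Matrix.intCast_apply]
  | hgen x =>
    by_cases h : x = β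
    · subst h
      simp [residueHom_gen_self, kill_gen_of_mem]
    · simp [residueHom_gen_of_ne h, kill_gen_of_notMem, h, twist_gen]
  | hadd a b ha hb => simp [ha, hb]
  | hmul a b ha hb => simp [Matrix.mul_apply, Fin.sum_univ_two, ha, hb]

theorem residue_mul (β : X) (x y : Lambda r X) :
    residue r β (x * y) =
      twist r X (kill r {β} x) * residue r β y + residue r β x * kill r {β} y := by
  simp [residue, Matrix.mul_apply, Fin.sum_univ_two, residueHom_entries]

theorem residue_gen_self (β : X) : residue r β (gen r β) = 1 := by
  simp [residue, residueHom_gen_self]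

theorem residue_gen_of_ne {β x : X} (h : x ≠ β) : residue r β (gen r x) = 0 := by
  simp [residue, residueHom_gen_of_ne h]

theorem residue_intCast (β : X) (n : ℤ) : residue r β (n : Lambda r X) = 0 := by
  simp [residue, Matrix.intCast_apply]

theorem residue_gen_self_mul (β : X) (y : Lambda r X) :
    residue r β (gen r β * y) = kill r {β} y := by
  rw [residue_mul, kill_gen_of_mem (Set.mem_singleton β), residue_gen_self]
  simp

theorem residue_gen_mul_of_ne {β x : X} (h : x ≠ β) (y : Lambda r X) :
    residue r β (gen r x * y) = sgn r • (gen r x * residue r β y) := by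
  rw [residue_mul, kill_gen_of_notMem (by simpa using h), residue_gen_of_ne h, twist_gen,
    zero_mul, add_zero, smul_mul_assoc]

theorem eq_kill_add_gen_mul_residue (β : X) (x : Lambda r X) :
    x = kill r {β} x + gen r β * residue r β x := by
  induction x using Lambda.induction with
  | hint n => simp [residue_intCast]
  | hgen x =>
    by_cases h : x = β
    · subst h
      simp [residue_gen_self, kill_gen_of_mem]
    · simp [residue_gen_of_ne h, kill_gen_of_notMem, h]
  | hadd a b ha hb =>
    rw [map_add, map_add, mul_add, add_add_add_comm, ← ha, ← hb]
  | hmul a b ha hb =>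
    have h1 : kill r {β} a * (gen r β * residue r β b) =
        gen r β * (twist r X (kill r {β} a) * residue r β b) := by
      rw [← mul_assoc, mul_gen, mul_assoc]
    have h2 : gen r β * residue r β a * (gen r β * residue r β b) = 0 := by
      rw [mul_assoc, ← mul_assoc (residue r β a), mul_gen, ← mul_assoc, ← mul_assoc, gen_sq]
      simp
    calc a * b = (kill r {β} a + gen r β * residue r β a) *
          (kill r {β} b + gen r β * residue r β b) := by rw [← ha, ← hb]
      _ = _ := by
        rw [add_mul, mul_add, mul_add, h1, h2, residue_mul, map_mul, mul_add, mul_assoc]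
        abel

theorem kill_residue_self (β : X) (x : Lambda r X) :
    kill r {β} (residue r β x) = residue r β x := by
  induction x using Lambda.induction with
  | hint n => simp [residue_intCast]
  | hgen x =>
    by_cases h : x = β
    · subst h
      simp [residue_gen_self]
    · simp [residue_gen_of_ne h]
  | hadd a b ha hb => simp [ha, hb]
  | hmul a b ha hb => simp [residue_mul, ha, hb, kill_twist, kill_self]

theorem kill_residue_of_notMem {S : Set X} {β : X} (h : β ∉ S) (x : Lambda r X) :
    kill r S (residue r β x) = residue r β (kill r S x) := by
  induction x using Lambda.induction with
  | hint n => simp [residue_intCast]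
  | hgen x =>
    by_cases hx : x = β
    · subst hx
      simp [residue_gen_self, kill_gen_of_notMem h]
    · by_cases hS : x ∈ S
      · simp [residue_gen_of_ne hx, kill_gen_of_mem hS]
      · simp [residue_gen_of_ne hx, kill_gen_of_notMem hS]
  | hadd a b ha hb => simp [ha, hb]
  | hmul a b ha hb =>
    simp [residue_mul, ha, hb, kill_twist, kill_kill, Set.union_comm]

theorem kill_residue_eq_of_kill_eq {α β : X} {x : Lambda r X} (hx : kill r {α} x = x) :
    kill r {α} (residue r β x) = residue r β x := by
  by_cases h : β = α
  · rw [h, kill_residue_self]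
  · rw [kill_residue_of_notMem (by simpa using h), hx]

end Lambda

variable {V E E' : Type*}

/-! ### Arnold classes under concatenation and ring homomorphisms. -/

theorem edgeProd_append (r : ℕ) (u v : List (E × Bool)) :
    edgeProd r (u ++ v) = edgeProd r u * edgeProd r v := by
  simp [edgeProd]

theorem arnold_append (r : ℕ) (u v : List (E × Bool)) :
    arnold r (u ++ v) =
      arnold r u * edgeProd r v + sgn r ^ u.length • (edgeProd r u * arnold r v) := by
  induction u with
  | nil => simp
  | cons d u ih =>
    rw [List.cons_append, arnold_cons, ih, edgeProd_append, arnold_cons, edgeProd_cons,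
      List.length_cons, pow_succ']
    simp only [mul_add, add_mul, smul_add, smul_mul_assoc, mul_smul_comm, mul_assoc, smul_smul,
      add_assoc]

theorem arnold_mul_edgeProd (r : ℕ) (u v : List (E × Bool)) :
    arnold r u * edgeProd r v =
      sgn r ^ ((u.length + 1) * v.length) • (edgeProd r v * arnold r u) := by
  induction v with
  | nil => simp
  | cons d v ih =>
    rw [edgeProd_cons, ← mul_assoc, arnold_mul_gen, smul_mul_assoc, mul_assoc, ih, mul_smul_comm,
      smul_smul, mul_assoc, ← pow_add, List.length_cons]
    congr 2
    ring

/-- Both orders give the same two terms of the product rule. Hence a circuit may be rotated at the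
cost of a sign. -/
theorem arnold_append_comm (r : ℕ) (u v : List (E × Bool)) :
    arnold r (v ++ u) = sgn r ^ (u.length * v.length) • arnold r (u ++ v) := by
  have h (n : ℕ) : sgn r ^ n * sgn r ^ n = 1 := by rw [← mul_pow, sgn_mul_sgn, one_pow]
  rw [arnold_append, arnold_append, arnold_mul_edgeProd r v u, arnold_mul_edgeProd r u v,
    smul_add, smul_smul, smul_smul, add_comm]
  congr 2
  · rw [add_mul, one_mul, pow_add, ← mul_assoc, h, one_mul]
  · ring

theorem kill_edgeProd (r : ℕ) {S : Set E} {w : List (E × Bool)} (h : ∀ d ∈ w, d.1 ∉ S) :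
    Lambda.kill r S (edgeProd r w) = edgeProd r w := by
  induction w with
  | nil => simp
  | cons d w ih =>
    rw [edgeProd_cons, map_mul, ih fun x hx => h x (by simp [hx]),
      Lambda.kill_gen_of_notMem (h d (by simp))]

theorem twist_edgeProd (r : ℕ) (w : List (E × Bool)) :
    Lambda.twist r E (edgeProd r w) = sgn r ^ w.length • edgeProd r w := by
  induction w with
  | nil => simp
  | cons d w ih =>
    rw [edgeProd_cons, map_mul, ih, Lambda.twist_gen, smul_mul_assoc, mul_smul_comm, smul_smul,
      List.length_cons, pow_succ']

theorem twist_arnold (r : ℕ) (w : List (E × Bool)) :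
    Lambda.twist r E (arnold r w) = sgn r ^ (w.length + 1) • arnold r w := by
  induction w with
  | nil => simp
  | cons d w ih =>
    have h : sgn r ^ (w.length + 1 + 1) = sgn r ^ w.length := by
      rw [pow_succ, pow_succ, mul_assoc, sgn_mul_sgn, mul_one]
    rw [arnold_cons, map_add, map_zsmul, map_zsmul, map_mul, ih, twist_edgeProd, Lambda.twist_gen,
      List.length_cons, h, smul_add]
    congr 1
    · rw [smul_comm]
    · simp only [smul_mul_assoc, mul_smul_comm, smul_smul]
      congr 1
      rw [pow_succ, mul_assoc, sgn_mul_sgn, mul_one, mul_comm]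

/-- The common factor is the product of the `τ d`: by `hs`, an omitted step contributes the same `τ
d` as a retained one. -/
theorem exists_hom_edgeProd_arnold {r : ℕ} (F : Lambda r E →+* Lambda r E')
    (φ : E × Bool → E' × Bool) (τ : E × Bool → ℤ)
    (hF : ∀ d, F (Lambda.gen r d.1) = τ d • Lambda.gen r (φ d).1)
    (hs : ∀ d, arnoldSign r 0 d.2 = τ d * arnoldSign r 0 (φ d).2) (w : List (E × Bool)) :
    ∃ c : ℤ, F (edgeProd r w) = c • edgeProd r (w.map φ) ∧
      F (arnold r w) = c • arnold r (w.map φ) := by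
  induction w with
  | nil => exact ⟨1, by simp, by simp⟩
  | cons d w ih =>
    obtain ⟨c, h1, h2⟩ := ih
    refine ⟨τ d * c, ?_, ?_⟩
    · rw [edgeProd_cons, map_mul, h1, hF, List.map_cons, edgeProd_cons]
      simp only [smul_mul_assoc, mul_smul_comm, smul_smul, mul_comm]
    · rw [arnold_cons, map_add, map_zsmul, map_zsmul, map_mul, h1, h2, hF, List.map_cons,
        arnold_cons, hs]
      simp only [smul_mul_assoc, mul_smul_comm, smul_smul, smul_add]
      congr 2 <;> ring

/-! ### Walks and the vertices of a contraction. -/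

theorem OGraph.isWalk_append {Γ : OGraph V E} {p q : List (E × Bool)} {u v : V} :
    Γ.IsWalk u (p ++ q) v ↔ ∃ x, Γ.IsWalk u p x ∧ Γ.IsWalk x q v := by
  induction p generalizing u with
  | nil => simp [IsWalk]
  | cons d p ih => simp [IsWalk, ih, and_assoc]

/-- The graph `Γ / α` together with the edge `α`, which becomes a loop. -/
def OGraph.contractAll (Γ : OGraph V E) (α : E) : OGraph (Γ.ContractVertex α) E where
  src e := Quot.mk _ (Γ.src e)
  tgt e := Quot.mk _ (Γ.tgt e)

theorem OGraph.contractAll_start (Γ : OGraph V E) (α : E) (d : E × Bool) :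
    (Γ.contractAll α).start d = Quot.mk _ (Γ.start d) := by
  rcases d with ⟨e, _ | _⟩ <;> rfl

theorem OGraph.contractAll_finish (Γ : OGraph V E) (α : E) (d : E × Bool) :
    (Γ.contractAll α).finish d = Quot.mk _ (Γ.finish d) := by
  rcases d with ⟨e, _ | _⟩ <;> rfl

/-- The map that moves `tgt α` to `src α` and fixes all other vertices descends to the quotient and
separates its points. -/
theorem OGraph.contractVertex_eq {Γ : OGraph V E} {α : E} {u v : V}
    (h : (Quot.mk _ u : Γ.ContractVertex α) = Quot.mk _ v) :
    u = v ∨ (u = Γ.src α ∨ u = Γ.tgt α) ∧ (v = Γ.src α ∨ v = Γ.tgt α) := by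
  classical
  have h' := congrArg (Quot.lift (fun v => if v = Γ.tgt α then Γ.src α else v) (by
    rintro a b ⟨rfl, rfl⟩
    simp)) h
  simp only at h'
  split_ifs at h' with h1 h2 h2
  · exact Or.inl (h1.trans h2.symm)
  · exact Or.inr ⟨Or.inr h1, Or.inl h'.symm⟩
  · exact Or.inr ⟨Or.inl h', Or.inr h2⟩
  · exact Or.inl h'

theorem OGraph.contractVertex_src (Γ : OGraph V E) (α : E) {v : V}
    (h : v = Γ.src α ∨ v = Γ.tgt α) :
    (Quot.mk _ v : Γ.ContractVertex α) = Quot.mk _ (Γ.src α) := by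
  rcases h with rfl | rfl
  · rfl
  · exact (Quot.sound ⟨rfl, rfl⟩).symm

/-- The ideal of `Λ^r[E]` generated by the Arnold classes of the circuits with edges in `S`. -/
def circuitIdeal (r : ℕ) (Γ : OGraph V E) (S : Set E) : Ideal (Lambda r E) :=
  Ideal.span {x | ∃ w, Γ.IsCircuit w ∧ (∀ d ∈ w, d.1 ∈ S) ∧ x = arnold r w}

/-! ### Ideals generated by circuits with prescribed edges. -/

section circuitIdeal

variable {r : ℕ} {Γ : OGraph V E} {S T : Set E}

theorem arnold_mem_circuitIdeal {w : List (E × Bool)} (hw : Γ.IsCircuit w)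
    (hS : ∀ d ∈ w, d.1 ∈ S) : arnold r w ∈ circuitIdeal r Γ S :=
  Ideal.subset_span ⟨w, hw, hS, rfl⟩

theorem circuitIdeal_mono (h : S ⊆ T) : circuitIdeal r Γ S ≤ circuitIdeal r Γ T :=
  Ideal.span_mono fun _ ⟨w, hw, hS, hx⟩ => ⟨w, hw, fun d hd => h (hS d hd), hx⟩

theorem circuitIdeal_induction {P : Lambda r E → Prop}
    (arnold : ∀ w, Γ.IsCircuit w → (∀ d ∈ w, d.1 ∈ S) → P (arnold r w))
    (zero : P 0) (add : ∀ x y, P x → P y → P (x + y))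
    (mul : ∀ c, ∀ x ∈ circuitIdeal r Γ S, P x → P (c * x))
    {x : Lambda r E} (hx : x ∈ circuitIdeal r Γ S) : P x := by
  unfold circuitIdeal at hx
  induction hx using Submodule.span_induction with
  | mem y hy => obtain ⟨w, hw, hS, rfl⟩ := hy; exact arnold w hw hS
  | zero => exact zero
  | add y z _ _ hy hz => exact add y z hy hz
  | smul c y hm hy => exact mul c y hm hy

theorem map_mem_of_mem_circuitIdeal {A : Type*} [Ring A] (F : Lambda r E →+* A) (I : Ideal A)
    (hF : ∀ w, Γ.IsCircuit w → (∀ d ∈ w, d.1 ∈ S) → F (arnold r w) ∈ I)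
    {x : Lambda r E} (hx : x ∈ circuitIdeal r Γ S) : F x ∈ I :=
  circuitIdeal_induction (P := fun x => F x ∈ I) hF (by simp)
    (fun x y hx hy => by rw [map_add]; exact add_mem hx hy)
    (fun c x _ hx => by rw [map_mul]; exact I.mul_mem_left _ hx) hx

theorem arnoldSign_mul_self (r i : ℕ) (b : Bool) : arnoldSign r i b * arnoldSign r i b = 1 := by
  unfold arnoldSign
  split_ifs
  · rw [← pow_add, ← two_mul]; simp
  all_goals simp

/-- Multiplying the Arnold class by its first generator annihilates every term but the one that
omits it. -/
theorem edgeProd_mem_circuitIdeal {w : List (E × Bool)} (hw : Γ.IsCircuit w)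
    (hS : ∀ d ∈ w, d.1 ∈ S) : edgeProd r w ∈ circuitIdeal r Γ S := by
  obtain ⟨d, v, rfl⟩ := List.exists_cons_of_ne_nil hw.1
  have h : edgeProd r (d :: v) =
      arnoldSign r 0 d.2 • (Lambda.gen r d.1 * arnold r (d :: v)) := by
    rw [arnold_cons, mul_add, mul_smul_comm, mul_smul_comm, ← mul_assoc, Lambda.gen_sq, zero_mul,
      smul_zero, add_zero, edgeProd_cons, smul_smul, arnoldSign_mul_self, one_smul]
  rw [h]
  exact zsmul_mem (Ideal.mul_mem_left _ _ (arnold_mem_circuitIdeal hw hS)) _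

theorem circuitIdeal_eq_top_of_loop {β : E} (hβ : β ∈ S) (h : Γ.src β = Γ.tgt β) :
    circuitIdeal r Γ S = ⊤ := by
  rw [Ideal.eq_top_iff_one]
  have hw : Γ.IsCircuit [(β, true)] := ⟨by simp, Γ.src β, rfl, h.symm⟩
  have := arnold_mem_circuitIdeal (r := r) hw (S := S) (by simpa using hβ)
  have hs : arnold r [(β, true)] = (1 : Lambda r E) := by
    simp [arnold_cons, arnoldSign]
  rwa [hs] at this

/-- Without loops a circuit has length at least two, so each term of its Arnold class retains a
generator from `S`. -/
theorem kill_eq_zero_of_mem_circuitIdeal (hloop : ∀ β ∈ S, Γ.src β ≠ Γ.tgt β) {x : Lambda r E}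
    (hx : x ∈ circuitIdeal r Γ S) : Lambda.kill r S x = 0 := by
  refine map_mem_of_mem_circuitIdeal (Lambda.kill r S) ⊥ ?_ hx
  rintro w ⟨hne, v, hw⟩ hS
  match w, hne, hw, hS with
  | [(e, b)], _, hw, hS =>
    have := hloop e (hS (e, b) (by simp))
    obtain ⟨h1, h2⟩ := hw
    cases b
    · exact absurd (h2.trans h1.symm) this
    · exact absurd (h1.trans h2.symm) this
  | d :: d' :: w, _, _, hS =>
    simp [arnold_cons, Lambda.kill_gen_of_mem (hS d (by simp)),
      Lambda.kill_gen_of_mem (hS d' (by simp))]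

end circuitIdeal

/-! ### Residues of circuits -/

/-- The steps of `w` along edges other than `α`, as steps in the original set of edges. -/
def dropEdgeVal (α : E) (w : List (E × Bool)) : List (E × Bool) :=
  (dropEdge α w).map (Prod.map Subtype.val id)

theorem dropEdgeVal_cons_self (α : E) (b : Bool) (w : List (E × Bool)) :
    dropEdgeVal α ((α, b) :: w) = dropEdgeVal α w := by
  simp [dropEdgeVal, dropEdge]

theorem dropEdgeVal_cons_of_ne {α e : E} (h : e ≠ α) (b : Bool) (w : List (E × Bool)) :
    dropEdgeVal α ((e, b) :: w) = (e, b) :: dropEdgeVal α w := by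
  simp [dropEdgeVal, dropEdge, h]

theorem mem_dropEdgeVal {α : E} {w : List (E × Bool)} {d : E × Bool}
    (h : d ∈ dropEdgeVal α w) : d ∈ w ∧ d.1 ≠ α := by
  induction w with
  | nil => simp [dropEdgeVal, dropEdge] at h
  | cons d' w ih =>
    obtain ⟨e, b⟩ := d'
    by_cases he : e = α
    · subst he
      rw [dropEdgeVal_cons_self] at h
      exact ⟨List.mem_cons_of_mem _ (ih h).1, (ih h).2⟩
    · rw [dropEdgeVal_cons_of_ne he, List.mem_cons] at h
      rcases h with rfl | h
      · exact ⟨by simp, he⟩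
      · exact ⟨List.mem_cons_of_mem _ (ih h).1, (ih h).2⟩

/-- The coefficient `sgn r * m'` is tied to `m'` so that, when a step other than `α` is prepended,
the terms reassemble into the Arnold class of the longer walk. -/
theorem exists_kill_residue_edgeProd_arnold (r : ℕ) (α : E) (w : List (E × Bool)) :
    ∃ m n m' n' : ℤ,
      Lambda.kill r {α} (edgeProd r w) = m • edgeProd r (dropEdgeVal α w) ∧
      Lambda.kill r {α} (arnold r w) =
        m • arnold r (dropEdgeVal α w) + n • edgeProd r (dropEdgeVal α w) ∧
      Lambda.residue r α (edgeProd r w) = m' • edgeProd r (dropEdgeVal α w) ∧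
      Lambda.residue r α (arnold r w) =
        (sgn r * m') • arnold r (dropEdgeVal α w) + n' • edgeProd r (dropEdgeVal α w) := by
  induction w with
  | nil =>
    have h1 : Lambda.residue r α 1 = 0 := by simpa using Lambda.residue_intCast (r := r) α 1
    exact ⟨1, 0, 0, 0, by simp [dropEdgeVal, dropEdge], by simp [dropEdgeVal, dropEdge],
      by simp [h1], by simp⟩
  | cons d w ih =>
    obtain ⟨e, b⟩ := d
    obtain ⟨m, n, m', n', h1, h2, h3, h4⟩ := ih
    by_cases he : e = α
    · subst he
      rw [dropEdgeVal_cons_self]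
      refine ⟨0, arnoldSign r 0 b * m, m, arnoldSign r 0 b * m' + sgn r * n, ?_, ?_, ?_, ?_⟩
      · rw [edgeProd_cons, map_mul, Lambda.kill_gen_of_mem (Set.mem_singleton e)]
        simp
      · rw [arnold_cons, map_add, map_zsmul, map_zsmul, map_mul,
          Lambda.kill_gen_of_mem (Set.mem_singleton e), h1, smul_smul]
        simp
      · rw [edgeProd_cons, Lambda.residue_gen_self_mul, h1]
      · rw [arnold_cons, map_add, map_zsmul, map_zsmul, Lambda.residue_gen_self_mul, h2, h3]
        simp only [smul_add, smul_smul, add_smul]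
        abel
    · rw [dropEdgeVal_cons_of_ne he]
      refine ⟨m, sgn r * n, sgn r * m', n', ?_, ?_, ?_, ?_⟩
      · rw [edgeProd_cons, map_mul, Lambda.kill_gen_of_notMem (by simpa using he), h1,
          edgeProd_cons, mul_smul_comm]
      · rw [arnold_cons, map_add, map_zsmul, map_zsmul, map_mul,
          Lambda.kill_gen_of_notMem (by simpa using he), h1, h2, arnold_cons, edgeProd_cons]
        simp only [mul_add, smul_add, smul_smul, mul_smul_comm, add_assoc]
        module
      · rw [edgeProd_cons, Lambda.residue_gen_mul_of_ne he, h3, edgeProd_cons, mul_smul_comm,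
          smul_smul]
      · rw [arnold_cons, map_add, map_zsmul, map_zsmul, Lambda.residue_gen_mul_of_ne he, h3, h4,
          arnold_cons, edgeProd_cons]
        simp only [mul_add, smul_add, smul_smul, mul_smul_comm]
        match_scalars
        · linear_combination -(arnoldSign r 0 b * m') * sgn_mul_sgn r
        · ring
        · linear_combination n' * sgn_mul_sgn r

theorem OGraph.IsWalk.dropEdgeVal {Γ : OGraph V E} {α : E} {w : List (E × Bool)} {u v : V}
    (h : Γ.IsWalk u w v) :
    (Γ.contractAll α).IsWalk (Quot.mk _ u) (dropEdgeVal α w) (Quot.mk _ v) :=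
  (isWalk_dropEdge α h).map (Γ' := Γ.contractAll α) (f := Subtype.val) (g := id)
    (fun _ => rfl) (fun _ => rfl)

/-! ### Relations of `Γ` versus relations of `Γ / α`. -/

section Contraction

variable {r : ℕ} {Γ : OGraph V E} {S : Set E} {α : E}

/-- A circuit running only along the non-loop `α` has Arnold class zero. Any other leaves a nonempty
circuit of `Γ / α`, whose Arnold class and edge product are both relations. -/
theorem kill_residue_arnold_mem (hα : Γ.src α ≠ Γ.tgt α) {w : List (E × Bool)}
    (hw : Γ.IsCircuit w) (hS : ∀ d ∈ w, d.1 ∈ S) :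
    Lambda.kill r {α} (arnold r w) ∈ circuitIdeal r (Γ.contractAll α) (S \ {α}) ∧
      Lambda.residue r α (arnold r w) ∈ circuitIdeal r (Γ.contractAll α) (S \ {α}) := by
  obtain ⟨hne, v, hw⟩ := hw
  by_cases hd : dropEdge α w = []
  · rw [arnold_eq_zero_of_dropEdge_eq_nil hα hw hd, map_zero, map_zero]
    exact ⟨zero_mem _, zero_mem _⟩
  · have hc : (Γ.contractAll α).IsCircuit (dropEdgeVal α w) :=
      ⟨by simpa [dropEdgeVal] using hd, _, hw.dropEdgeVal⟩
    have hS' : ∀ d ∈ dropEdgeVal α w, d.1 ∈ S \ {α} := fun d hd =>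
      ⟨hS d (mem_dropEdgeVal hd).1, (mem_dropEdgeVal hd).2⟩
    obtain ⟨m, n, m', n', -, h2, -, h4⟩ := exists_kill_residue_edgeProd_arnold r α w
    rw [h2, h4]
    have ha := arnold_mem_circuitIdeal (r := r) hc hS'
    have he := edgeProd_mem_circuitIdeal (r := r) hc hS'
    exact ⟨add_mem (zsmul_mem ha _) (zsmul_mem he _), add_mem (zsmul_mem ha _) (zsmul_mem he _)⟩

theorem residue_mem_circuitIdeal (hα : Γ.src α ≠ Γ.tgt α) {x : Lambda r E}
    (hx : x ∈ circuitIdeal r Γ S) :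
    Lambda.residue r α x ∈ circuitIdeal r (Γ.contractAll α) (S \ {α}) := by
  refine circuitIdeal_induction (P := fun x => Lambda.residue r α x ∈ circuitIdeal r _ _)
    (fun w hw hS => (kill_residue_arnold_mem hα hw hS).2) (by simp)
    (fun x y hx hy => by rw [map_add]; exact add_mem hx hy) (fun c x hm hx => ?_) hx
  -- The twisted Leibniz rule also involves `x` with `e_α` set to zero, which is a relation of `Γ /
  -- α` too.
  rw [Lambda.residue_mul]
  refine add_mem (Ideal.mul_mem_left _ _ hx) (Ideal.mul_mem_left _ _ ?_)
  exact map_mem_of_mem_circuitIdeal _ _ (fun w hw hS => (kill_residue_arnold_mem hα hw hS).1) hm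

/-- The elements `b` such that `e_α * b` is congruent, modulo the Arnold classes of the circuits
with edges in `S ∪ {α}`, to an element that does not involve `e_α`. -/
def residueIdeal (r : ℕ) (Γ : OGraph V E) (S : Set E) (α : E) : Ideal (Lambda r E) where
  carrier := {b | ∃ a, Lambda.kill r {α} a = a ∧
    a + Lambda.gen r α * b ∈ circuitIdeal r Γ (insert α S)}
  zero_mem' := ⟨0, by simp, by simp⟩
  add_mem' := by
    rintro b b' ⟨a, ha, h⟩ ⟨a', ha', h'⟩
    refine ⟨a + a', by rw [map_add, ha, ha'], ?_⟩
    rw [mul_add, add_add_add_comm]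
    exact add_mem h h'
  smul_mem' := by
    rintro c b ⟨a, ha, h⟩
    refine ⟨Lambda.twist r E (Lambda.kill r {α} c) * a, ?_, ?_⟩
    · rw [map_mul, Lambda.kill_twist, Lambda.kill_self, ha]
    -- The part of `c` containing `e_α` is annihilated by the `e_α` in front; the rest moves past it
    -- with a twist.
    · have hc : Lambda.gen r α * (c * b) =
          Lambda.twist r E (Lambda.kill r {α} c) * (Lambda.gen r α * b) := by
        rw [← mul_assoc (Lambda.twist r E _), Lambda.mul_gen, Lambda.twist_twist,
          Lambda.eq_kill_add_gen_mul_residue α c]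
        simp only [map_add, map_mul, Lambda.kill_self,
          Lambda.kill_gen_of_mem (Set.mem_singleton α), zero_mul, add_zero, mul_add, add_mul,
          mul_assoc]
        rw [← mul_assoc (Lambda.gen r α) (Lambda.gen r α), Lambda.gen_sq, zero_mul, add_zero]
      rw [smul_eq_mul, hc, ← mul_add]
      exact Ideal.mul_mem_left _ _ h

/-- A closed walk is itself a relation, up to the empty case. Otherwise a step along `α` closes `p`,
and the Arnold class of that circuit is `± e_p + sgn r • e_α A(p)`. -/
theorem arnold_mem_residueIdeal_of_isWalk (hα : α ∉ S) {p : List (E × Bool)} {u v : V}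
    (hu : u = Γ.src α ∨ u = Γ.tgt α) (hv : v = Γ.src α ∨ v = Γ.tgt α) (hp : Γ.IsWalk u p v)
    (hS : ∀ d ∈ p, d.1 ∈ S) : arnold r p ∈ residueIdeal r Γ S α := by
  by_cases huv : u = v
  · subst huv
    by_cases hne : p = []
    · rw [hne, arnold_nil]
      exact zero_mem _
    · refine ⟨0, map_zero _, ?_⟩
      rw [zero_add]
      exact Ideal.mul_mem_left _ _
        (arnold_mem_circuitIdeal ⟨hne, u, hp⟩ fun d hd => Set.mem_insert_of_mem _ (hS d hd))
  · obtain ⟨b, hb⟩ : ∃ b, Γ.start (α, b) = v ∧ Γ.finish (α, b) = u := by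
      rcases hu with rfl | rfl <;> rcases hv with rfl | rfl
      · exact absurd rfl huv
      · exact ⟨false, rfl, rfl⟩
      · exact ⟨true, rfl, rfl⟩
      · exact absurd rfl huv
    have hc : Γ.IsCircuit ((α, b) :: p) := ⟨by simp, v, hb.1, hb.2 ▸ hp⟩
    have hm := arnold_mem_circuitIdeal (r := r) hc (S := insert α S) (by
      intro d hd
      rcases List.mem_cons.mp hd with rfl | hd
      · exact Set.mem_insert _ _
      · exact Set.mem_insert_of_mem _ (hS d hd))
    refine ⟨(sgn r * arnoldSign r 0 b) • edgeProd r p, ?_, ?_⟩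
    · rw [map_zsmul, kill_edgeProd]
      intro d hd h
      exact hα (h ▸ hS d hd)
    · have := zsmul_mem hm (sgn r)
      rwa [arnold_cons, smul_add, smul_smul, smul_smul, sgn_mul_sgn, one_smul] at this

/-- Steps of `w` are appended to `p` as long as they continue it in `Γ`. At a jump between the ends
of `α` the word is cut: `p` then joins two ends of `α`, the remainder is a shorter instance, and the
product rule combines them. -/
theorem arnold_append_mem_residueIdeal (hα : α ∉ S) {p w : List (E × Bool)} {u v : V}
    (hu : u = Γ.src α ∨ u = Γ.tgt α) (hp : Γ.IsWalk u p v) (hpS : ∀ d ∈ p, d.1 ∈ S)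
    (hw : (Γ.contractAll α).IsWalk (Quot.mk _ v) w (Quot.mk _ (Γ.src α)))
    (hwS : ∀ d ∈ w, d.1 ∈ S) : arnold r (p ++ w) ∈ residueIdeal r Γ S α := by
  induction w generalizing p u v with
  | nil =>
    rw [List.append_nil]
    refine arnold_mem_residueIdeal_of_isWalk hα hu ?_ hp hpS
    rcases OGraph.contractVertex_eq hw with h | h
    · exact Or.inl h
    · exact h.1
  | cons d w ih =>
    obtain ⟨h1, h2⟩ := hw
    rw [OGraph.contractAll_start] at h1
    rw [OGraph.contractAll_finish] at h2
    have hdS : d.1 ∈ S := hwS d (by simp)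
    have hwS' : ∀ d ∈ w, d.1 ∈ S := fun x hx => hwS x (by simp [hx])
    rcases OGraph.contractVertex_eq h1 with h | ⟨hs, hv⟩
    · rw [List.append_cons]
      exact ih hu (OGraph.isWalk_append.mpr ⟨v, hp, h, rfl⟩)
        (List.forall_mem_append.mpr ⟨hpS, by simpa using hdS⟩) h2 hwS'
    · have ha := arnold_mem_residueIdeal_of_isWalk (r := r) hα hu hv hp hpS
      have hb := ih (p := [d]) hs ⟨rfl, rfl⟩ (by simpa using hdS) h2 hwS'
      rw [arnold_append, arnold_mul_edgeProd]
      exact add_mem (zsmul_mem (Ideal.mul_mem_left _ _ ha) _)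
        (zsmul_mem (Ideal.mul_mem_left _ _ hb) _)

/-- A walk of `Γ / α` that does not lift must jump between the ends of `α`, so it visits the
contracted vertex. -/
theorem OGraph.isWalk_or_exists_append {w : List (E × Bool)} {u v : V}
    (hw : (Γ.contractAll α).IsWalk (Quot.mk _ u) w (Quot.mk _ v)) :
    Γ.IsWalk u w v ∨ ∃ w₁ w₂, w = w₁ ++ w₂ ∧
      (Γ.contractAll α).IsWalk (Quot.mk _ u) w₁ (Quot.mk _ (Γ.src α)) ∧
      (Γ.contractAll α).IsWalk (Quot.mk _ (Γ.src α)) w₂ (Quot.mk _ v) := by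
  induction w generalizing u with
  | nil =>
    rcases OGraph.contractVertex_eq hw with h | ⟨h, h'⟩
    · exact Or.inl h
    · exact Or.inr ⟨[], [], rfl, Γ.contractVertex_src α h, (Γ.contractVertex_src α h').symm⟩
  | cons d w ih =>
    obtain ⟨h1, h2⟩ := id hw
    rw [OGraph.contractAll_start] at h1
    rw [OGraph.contractAll_finish] at h2
    rcases OGraph.contractVertex_eq h1 with h | ⟨-, h⟩
    · rcases ih h2 with h' | ⟨w₁, w₂, rfl, h₁, h₂⟩
      · exact Or.inl ⟨h, h'⟩
      · refine Or.inr ⟨d :: w₁, w₂, rfl, ⟨?_, ?_⟩, h₂⟩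
        · rw [contractAll_start, h1]
        · rwa [contractAll_finish]
    · refine Or.inr ⟨[], d :: w, rfl, Γ.contractVertex_src α h, ?_⟩
      rwa [← Γ.contractVertex_src α h]

theorem circuitIdeal_contractAll_le (hα : α ∉ S) :
    circuitIdeal r (Γ.contractAll α) S ≤ residueIdeal r Γ S α := by
  refine Ideal.span_le.mpr ?_
  rintro _ ⟨w, ⟨hne, v, hw⟩, hS, rfl⟩
  obtain ⟨v, rfl⟩ := Quot.exists_rep v
  rcases OGraph.isWalk_or_exists_append hw with h | ⟨w₁, w₂, rfl, h₁, h₂⟩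
  · refine ⟨0, map_zero _, ?_⟩
    rw [zero_add]
    exact Ideal.mul_mem_left _ _
      (arnold_mem_circuitIdeal ⟨hne, v, h⟩ fun d hd => Set.mem_insert_of_mem _ (hS d hd))
  -- Rotate the circuit so that it starts and ends at the contracted vertex.
  · rw [arnold_append_comm]
    refine zsmul_mem ?_ _
    exact arnold_append_mem_residueIdeal (p := []) hα (Or.inl rfl) rfl (by simp)
      (OGraph.isWalk_append.mpr ⟨_, h₂, h₁⟩)
      fun d hd => hS d (by simpa [or_comm] using hd)

end Contraction

/-! ### Parallel edges -/

/-- The step along `β` in the direction `b` has the same end points as the edge `γ`. -/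
def OGraph.IsParallel (Γ : OGraph V E) (γ β : E) (b : Bool) : Prop :=
  Γ.start (β, b) = Γ.src γ ∧ Γ.finish (β, b) = Γ.tgt γ

theorem OGraph.contractAll_src_ne_tgt {Γ : OGraph V E} {α β : E} (hα : Γ.src α ≠ Γ.tgt α)
    (h : ∀ b, ¬ Γ.IsParallel α β b) : (Γ.contractAll β).src α ≠ (Γ.contractAll β).tgt α := by
  intro he
  rcases contractVertex_eq he with he | ⟨h1, h2⟩
  · exact hα he
  · rcases h1 with h1 | h1 <;> rcases h2 with h2 | h2
    · exact hα (h1.trans h2.symm)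
    · exact h true ⟨h1.symm, h2.symm⟩
    · exact h false ⟨h1.symm, h2.symm⟩
    · exact hα (h1.trans h2.symm)

/-- The sign of the step `b` of an edge, as a generator of `Λ^r`. -/
def directionSign (r : ℕ) (b : Bool) : ℤ := if b then 1 else -sgn r

/-- The sign condition of `exists_hom_edgeProd_arnold` for rerouting a step along a parallel edge.
-/
theorem arnoldSign_eq_directionSign_mul (r : ℕ) (b c : Bool) :
    arnoldSign r 0 c = directionSign r b * arnoldSign r 0 (if c then b else !b) := by
  unfold arnoldSign directionSign sgn
  by_cases hr : Even r
  · rw [hr.add_one.neg_one_pow]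
    simp [hr]
  · rw [(Nat.not_even_iff_odd.mp hr).add_one.neg_one_pow]
    cases b <;> cases c <;> simp [hr]

open Classical in
/-- The endomorphism of `Λ^r[E]` that replaces the edge `γ` by the step `(β, b)`. -/
def substitute (r : ℕ) (γ β : E) (b : Bool) : Lambda r E →+* Lambda r E :=
  Lambda.scaleMap r (fun x => if x = γ then directionSign r b else 1)
    (fun x => if x = γ then β else x)

theorem substitute_gen_self (r : ℕ) (γ β : E) (b : Bool) :
    substitute r γ β b (Lambda.gen r γ) = directionSign r b • Lambda.gen r β := by
  simp [substitute, Lambda.scaleMap_gen]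

theorem substitute_gen_of_ne {r : ℕ} {γ x : E} (h : x ≠ γ) (β : E) (b : Bool) :
    substitute r γ β b (Lambda.gen r x) = Lambda.gen r x := by
  simp [substitute, Lambda.scaleMap_gen, h]

theorem substitute_eq_self {r : ℕ} {γ : E} {x : Lambda r E} (hx : Lambda.kill r {γ} x = x)
    (β : E) (b : Bool) : substitute r γ β b x = x := by
  have : (substitute r γ β b).comp (Lambda.kill r {γ}) = Lambda.kill r {γ} := by
    apply Lambda.hom_ext
    intro y
    by_cases h : y = γ
    · subst h
      simp [Lambda.kill_gen_of_mem]
    · simp [Lambda.kill_gen_of_notMem, substitute_gen_of_ne, h]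
  rw [← hx]
  exact RingHom.congr_fun this x

theorem kill_substitute {r : ℕ} {α γ β : E} (hγ : γ ≠ α) (hβ : β ≠ α) (b : Bool)
    (x : Lambda r E) :
    Lambda.kill r {α} (substitute r γ β b x) = substitute r γ β b (Lambda.kill r {α} x) := by
  have : (Lambda.kill r {α}).comp (substitute r γ β b) =
      (substitute r γ β b).comp (Lambda.kill r {α}) := by
    apply Lambda.hom_ext
    intro y
    by_cases h : y = γ
    · subst h
      simp [Lambda.kill_gen_of_notMem, hγ, hβ, substitute_gen_self]
    · by_cases h' : y = α
      · subst h'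
        simp [substitute_gen_of_ne h, Lambda.kill_gen_of_mem]
      · simp [substitute_gen_of_ne h, Lambda.kill_gen_of_notMem, h']
  exact RingHom.congr_fun this x

section Parallel

variable {r : ℕ} {Γ : OGraph V E} {S T : Set E} {γ β : E} {b : Bool}

open Classical in
theorem OGraph.IsWalk.substitute (h : Γ.IsParallel γ β b) {w : List (E × Bool)} {u v : V}
    (hw : Γ.IsWalk u w v) :
    Γ.IsWalk u (w.map fun d => if d.1 = γ then (β, if d.2 then b else !b) else d) v := by
  induction w generalizing u with
  | nil => exact hw
  | cons d w ih =>
    obtain ⟨e, c⟩ := d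
    obtain ⟨rfl, h2⟩ := hw
    by_cases he : e = γ
    · subst he
      have hs : Γ.start (β, if c then b else !b) = Γ.start (e, c) := by
        cases b <;> cases c <;> first | exact h.1 | exact h.2
      have hf : Γ.finish (β, if c then b else !b) = Γ.finish (e, c) := by
        cases b <;> cases c <;> first | exact h.1 | exact h.2
      rw [List.map_cons, if_pos rfl]
      exact ⟨hs, hf ▸ ih h2⟩
    · rw [List.map_cons, if_neg he]
      exact ⟨rfl, ih h2⟩

theorem substitute_mem_circuitIdeal (h : Γ.IsParallel γ β b) (hβ : β ∈ S) (hT : T ⊆ insert γ S)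
    {x : Lambda r E} (hx : x ∈ circuitIdeal r Γ T) :
    substitute r γ β b x ∈ circuitIdeal r Γ S := by
  classical
  refine map_mem_of_mem_circuitIdeal _ _ (fun w hw hwT => ?_) hx
  obtain ⟨c, -, hc⟩ := exists_hom_edgeProd_arnold (substitute r γ β b)
    (fun d => if d.1 = γ then (β, if d.2 then b else !b) else d)
    (fun d => if d.1 = γ then directionSign r b else 1)
    (by
      intro d
      by_cases hd : d.1 = γ
      · simp [hd, substitute_gen_self]
      · simp [hd, substitute_gen_of_ne])
    (by
      intro d
      by_cases hd : d.1 = γ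
      · simpa [hd] using arnoldSign_eq_directionSign_mul r b d.2
      · simp [hd]) w
  rw [hc]
  obtain ⟨hne, v, hv⟩ := hw
  refine zsmul_mem (arnold_mem_circuitIdeal ⟨by simpa using hne, v, hv.substitute h⟩ ?_) c
  intro d hd
  obtain ⟨d', hd', rfl⟩ := List.mem_map.mp hd
  by_cases hγ : d'.1 = γ
  · simpa [hγ] using hβ
  · simpa [hγ] using hT (hwT d' hd')

theorem gen_sub_gen_mem_circuitIdeal (h : Γ.IsParallel γ β b) (hγ : γ ∈ S) (hβ : β ∈ S) :
    Lambda.gen r γ - directionSign r b • Lambda.gen r β ∈ circuitIdeal r Γ S := by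
  have hw : Γ.IsCircuit [(γ, true), (β, !b)] := by
    refine ⟨by simp, Γ.src γ, rfl, ?_, ?_⟩
    · cases b <;> exact h.2
    · cases b <;> exact h.1
  -- The circuit goes along `γ` and back along `β`; the factor gives `e_γ` coefficient one.
  have hm := zsmul_mem (arnold_mem_circuitIdeal (r := r) hw (S := S) (by simp [hγ, hβ]))
    (sgn r * arnoldSign r 0 (!b))
  convert hm using 1
  simp only [arnold_cons, arnold_nil, edgeProd_cons, edgeProd_nil, mul_one, mul_zero, smul_zero,
    add_zero, mul_smul_comm, smul_add, smul_smul]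
  have h1 : sgn r * arnoldSign r 0 (!b) * (sgn r * arnoldSign r 0 (!b)) = 1 := by
    rw [mul_mul_mul_comm, sgn_mul_sgn, arnoldSign_mul_self, one_mul]
  have h2 : sgn r * arnoldSign r 0 (!b) * arnoldSign r 0 true = -directionSign r b := by
    unfold arnoldSign directionSign sgn
    by_cases hr : Even r
    · rw [hr.add_one.neg_one_pow]
      simp [hr]
    · rw [(Nat.not_even_iff_odd.mp hr).add_one.neg_one_pow]
      cases b <;> simp [hr]
  rw [h1, h2, one_smul, neg_smul]
  abel

/-- With `x = a + e_γ b`, the difference is `e_γ ∓ e_β` times `b`, and a twist moves `b` to the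
left. -/
theorem sub_substitute_mem_circuitIdeal (h : Γ.IsParallel γ β b) (hγ : γ ∈ S) (hβ : β ∈ S)
    (x : Lambda r E) : x - substitute r γ β b x ∈ circuitIdeal r Γ S := by
  have hx : x - substitute r γ β b x = Lambda.twist r E (Lambda.residue r γ x) *
      (Lambda.gen r γ - directionSign r b • Lambda.gen r β) := by
    conv_lhs => rw [Lambda.eq_kill_add_gen_mul_residue γ x]
    rw [map_add, map_mul, substitute_eq_self (Lambda.kill_self _ _),
      substitute_eq_self (Lambda.kill_residue_self _ _), substitute_gen_self, mul_sub,
      mul_smul_comm, Lambda.mul_gen, Lambda.mul_gen, Lambda.twist_twist, smul_mul_assoc]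
    abel
  rw [hx]
  exact Ideal.mul_mem_left _ _ (gen_sub_gen_mem_circuitIdeal h hγ hβ)

end Parallel

/-! ### Deletion is injective -/

/-- Adding an edge to the edges in `S` does not create new relations between these. -/
def DeletionInjective (r : ℕ) (Γ : OGraph V E) (S : Set E) : Prop :=
  ∀ α ∉ S, Γ.src α ≠ Γ.tgt α → ∀ x ∈ circuitIdeal r Γ (insert α S),
    Lambda.kill r {α} x = x → x ∈ circuitIdeal r Γ S

/-- An integration principle: generators of `S` are eliminated from `x` one at a time, each by a
relation with the same residue as `x`. -/
theorem sub_kill_mem_circuitIdeal {r n : ℕ} {V : Type u} {Γ : OGraph V E} {S : Set E}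
    (ih : ∀ (V' : Type u) (Γ' : OGraph V' E) (T : Set E), T.Finite → T.ncard < n →
      DeletionInjective r Γ' T)
    (hfin : S.Finite) (hn : S.ncard ≤ n) (hloop : ∀ β ∈ S, Γ.src β ≠ Γ.tgt β)
    (hpar : ∀ γ ∈ S, ∀ β ∈ S, β ≠ γ → ∀ b, ¬ Γ.IsParallel γ β b) (x : Lambda r E)
    (hx : ∀ β ∈ S, Lambda.residue r β x ∈ circuitIdeal r (Γ.contractAll β) (S \ {β})) :
    x - Lambda.kill r S x ∈ circuitIdeal r Γ S := by
  induction S, hfin using Set.Finite.induction_on generalizing x with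
  | empty =>
    have : Lambda.kill r (∅ : Set E) = RingHom.id (Lambda r E) :=
      Lambda.hom_ext fun y => by simp [Lambda.kill_gen_of_notMem]
    simp [this]
  | @insert γ S hγ hfin ihS =>
    have hS : insert γ S \ {γ} = S := by
      ext y
      simp only [Set.mem_sdiff, Set.mem_insert_iff, Set.mem_singleton_iff]
      exact ⟨fun h => h.1.resolve_left h.2, fun h => ⟨Or.inr h, fun hy => hγ (hy ▸ h)⟩⟩
    have hcard := Set.ncard_insert_of_notMem hγ hfin
    have h1 := hx γ (Set.mem_insert _ _)
    rw [hS] at h1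
    obtain ⟨a, ha, ham⟩ := circuitIdeal_contractAll_le hγ h1
    -- Subtracting from `x` a relation with the same residue at `γ` leaves an element free of `e_γ`.
    set y := Lambda.kill r {γ} x - a with hy
    have hyγ : Lambda.kill r {γ} y = y := by rw [hy, map_sub, ha, Lambda.kill_self]
    have hxy : x - y ∈ circuitIdeal r Γ (insert γ S) := by
      convert ham using 1
      conv_lhs => rw [Lambda.eq_kill_add_gen_mul_residue γ x]
      rw [hy]
      abel
    have hyS : y - Lambda.kill r S y ∈ circuitIdeal r Γ S := by
      refine ihS (by omega) (fun β hβ => hloop β (Set.mem_insert_of_mem _ hβ))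
        (fun γ hγ β hβ => hpar γ (Set.mem_insert_of_mem _ hγ) β (Set.mem_insert_of_mem _ hβ))
        y fun β hβ => ?_
      have hne : γ ≠ β := fun h => hγ (h ▸ hβ)
      have hβ' := Set.mem_insert_of_mem γ hβ
      have hins : insert γ S \ {β} = insert γ (S \ {β}) :=
        Set.insert_sdiff_of_notMem _ (by simpa using hne)
      -- The residue of `y` at `β` may still need circuits through `γ`. It is free of `e_γ`, and `γ`
      -- is not a loop in `Γ / β`, so injectivity for the smaller set removes them.
      refine ih _ (Γ.contractAll β) (S \ {β}) hfin.sdiff ?_ γ (fun h => hγ h.1) ?_ _ ?_ ?_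
      · have := Set.ncard_sdiff_singleton_le S β
        omega
      · exact OGraph.contractAll_src_ne_tgt (hloop γ (Set.mem_insert _ _))
          (hpar γ (Set.mem_insert _ _) β hβ' hne.symm)
      · rw [← hins]
        have h2 := sub_mem (hx β hβ') (residue_mem_circuitIdeal (hloop β hβ') hxy)
        rwa [← map_sub, sub_sub_cancel] at h2
      · exact Lambda.kill_residue_eq_of_kill_eq hyγ
    have hk : Lambda.kill r (insert γ S) x = Lambda.kill r S y := by
      have h0 := kill_eq_zero_of_mem_circuitIdeal hloop hxy
      rw [map_sub, sub_eq_zero] at h0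
      rw [h0]
      conv_rhs => rw [← hyγ, Lambda.kill_kill, Set.union_singleton]
    rw [hk, ← sub_add_sub_cancel x y]
    exact add_mem hxy (circuitIdeal_mono (Set.subset_insert _ _) hyS)

/-- The induction ranges over all vertex types because contraction changes them. -/
theorem deletionInjective_of_finite (r n : ℕ) : ∀ (V : Type u) (Γ : OGraph V E) (S : Set E),
    S.Finite → S.ncard = n → DeletionInjective r Γ S := by
  induction n using Nat.strong_induction_on with
  | _ n ih =>
    intro V Γ S hfin hn α hαS hα x hx hxα
    by_cases hloop : ∃ β ∈ S, Γ.src β = Γ.tgt β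
    · obtain ⟨β, hβ, h⟩ := hloop
      rw [circuitIdeal_eq_top_of_loop hβ h]
      trivial
    push Not at hloop
    by_cases hαpar : ∃ β ∈ S, ∃ b, Γ.IsParallel α β b
    · obtain ⟨β, hβ, b, h⟩ := hαpar
      rw [← substitute_eq_self hxα β b]
      exact substitute_mem_circuitIdeal h hβ le_rfl hx
    push Not at hαpar
    by_cases hpar : ∃ γ ∈ S, ∃ β ∈ S, β ≠ γ ∧ ∃ b, Γ.IsParallel γ β b
    · obtain ⟨γ, hγ, β, hβ, hne, b, h⟩ := hpar
      have hγα : γ ≠ α := fun h => hαS (h ▸ hγ)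
      have hβα : β ≠ α := fun h => hαS (h ▸ hβ)
      -- Modulo circuits in `S`, the edge `γ` is redundant; substituting `β` lowers the number of
      -- edges.
      have hF : substitute r γ β b x ∈ circuitIdeal r Γ (S \ {γ}) := by
        refine ih _ ?_ V Γ (S \ {γ}) hfin.sdiff rfl α (fun h => hαS h.1) hα _ ?_ ?_
        · rw [← hn]
          exact Set.ncard_sdiff_singleton_lt_of_mem hγ hfin
        · have hβ' : β ∈ S \ {γ} := ⟨hβ, hne⟩
          refine substitute_mem_circuitIdeal h (Set.mem_insert_of_mem _ hβ') ?_ hx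
          rw [Set.insert_comm, Set.insert_sdiff_singleton, Set.insert_eq_of_mem hγ]
        · rw [kill_substitute hγα hβα, hxα]
      rw [← sub_add_cancel x (substitute r γ β b x)]
      exact add_mem (sub_substitute_mem_circuitIdeal h hγ hβ x)
        (circuitIdeal_mono Set.sdiff_subset hF)
    push Not at hpar
    have hk := sub_kill_mem_circuitIdeal (n := n)
      (fun V' Γ' T hT hlt => ih _ hlt V' Γ' T hT rfl) hfin hn.le hloop hpar x (by
        intro β hβ
        have hβα : α ≠ β := fun h => hαS (h ▸ hβ)
        refine ih _ ?_ _ (Γ.contractAll β) (S \ {β}) hfin.sdiff rfl α (fun h => hαS h.1) ?_ _ ?_ ?_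
        · rw [← hn]
          exact Set.ncard_sdiff_singleton_lt_of_mem hβ hfin
        · exact OGraph.contractAll_src_ne_tgt hα (hαpar β hβ)
        · have := residue_mem_circuitIdeal (hloop β hβ) hx
          rwa [Set.insert_sdiff_of_notMem _ (by simpa using hβα)] at this
        · exact Lambda.kill_residue_eq_of_kill_eq hxα)
    -- As `x` is free of `e_α`, killing `S` amounts to killing all edges its relations may use.
    have h0 : Lambda.kill r S x = 0 := by
      rw [← hxα, Lambda.kill_kill, Set.union_singleton]
      refine kill_eq_zero_of_mem_circuitIdeal ?_ hx
      intro β hβ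
      rcases hβ with rfl | hβ
      · exact hα
      · exact hloop β hβ
    rwa [h0, sub_zero] at hk

theorem exists_finite_mem_circuitIdeal {r : ℕ} {Γ : OGraph V E} {S : Set E} {x : Lambda r E}
    (hx : x ∈ circuitIdeal r Γ S) : ∃ T ⊆ S, T.Finite ∧ x ∈ circuitIdeal r Γ T := by
  refine circuitIdeal_induction (P := fun x => ∃ T ⊆ S, T.Finite ∧ x ∈ circuitIdeal r Γ T)
    (fun w hw hS => ?_) ⟨∅, by simp, by simp, zero_mem _⟩ ?_ ?_ hx
  · refine ⟨{e | e ∈ w.map Prod.fst}, ?_, List.finite_toSet _, arnold_mem_circuitIdeal hw ?_⟩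
    · intro e he
      obtain ⟨d, hd, rfl⟩ := List.mem_map.mp he
      exact hS d hd
    · intro d hd
      exact List.mem_map.mpr ⟨d, hd, rfl⟩
  · rintro x y ⟨T, hT, hf, hx⟩ ⟨T', hT', hf', hy⟩
    exact ⟨T ∪ T', Set.union_subset hT hT', hf.union hf',
      add_mem (circuitIdeal_mono Set.subset_union_left hx)
        (circuitIdeal_mono Set.subset_union_right hy)⟩
  · rintro c x - ⟨T, hT, hf, hx⟩
    exact ⟨T, hT, hf, Ideal.mul_mem_left _ _ hx⟩

theorem deletionInjective (r : ℕ) (Γ : OGraph V E) (S : Set E) : DeletionInjective r Γ S := by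
  intro α hαS hα x hx hxα
  obtain ⟨T, hT, hf, hxT⟩ := exists_finite_mem_circuitIdeal hx
  have := deletionInjective_of_finite r _ V Γ (T \ {α}) hf.sdiff rfl α (by simp) hα x
    (circuitIdeal_mono (by rw [Set.insert_sdiff_singleton]; exact Set.subset_insert _ _) hxT) hxα
  refine circuitIdeal_mono ?_ this
  rintro e ⟨he, hne⟩
  exact (hT he).resolve_left hne

/-! ### Comparison with the rings of the deletion and the contraction -/

theorem arnoldIdeal_eq_circuitIdeal (r : ℕ) (Γ : OGraph V E) :
    arnoldIdeal r Γ = circuitIdeal r Γ Set.univ := by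
  simp [arnoldIdeal, circuitIdeal]

theorem R.mk_eq_zero_iff {r : ℕ} {Γ : OGraph V E} {x : Lambda r E} :
    R.mk r Γ x = 0 ↔ x ∈ circuitIdeal r Γ Set.univ := by
  rw [← arnoldIdeal_eq_circuitIdeal]
  exact Ideal.Quotient.eq_zero_iff_mem

open Classical in
/-- The map `Λ^r[E] → Λ^r[E ∖ α]` that sends `e_α` to zero. -/
def forgetEdge (r : ℕ) (α : E) : Lambda r E →+* Lambda r {e : E // e ≠ α} :=
  Lambda.lift (fun e => if h : e = α then 0 else Lambda.gen r ⟨e, h⟩)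
    (by
      intro a b
      split_ifs
      · simp
      · simp
      · simp
      · exact Lambda.gen_comm _ _)
    (by
      intro a
      split_ifs
      · simp
      · exact Lambda.gen_sq _)

theorem forgetEdge_map_val {r : ℕ} {α : E} (z : Lambda r {e : E // e ≠ α}) :
    forgetEdge r α (Lambda.map Subtype.val z) = z := by
  have : (forgetEdge r α).comp (Lambda.map Subtype.val) = RingHom.id _ :=
    Lambda.hom_ext fun x => by simp [forgetEdge, x.2]
  exact RingHom.congr_fun this z

theorem map_val_forgetEdge {r : ℕ} {α : E} (x : Lambda r E) :
    Lambda.map Subtype.val (forgetEdge r α x) = Lambda.kill r {α} x := by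
  have : (Lambda.map Subtype.val).comp (forgetEdge r α) = Lambda.kill r {α} := by
    apply Lambda.hom_ext
    intro y
    by_cases h : y = α
    · subst h
      simp [forgetEdge, Lambda.kill_gen_of_mem]
    · simp [forgetEdge, Lambda.kill_gen_of_notMem, h]
  exact RingHom.congr_fun this x

theorem kill_map_val {r : ℕ} {α : E} (z : Lambda r {e : E // e ≠ α}) :
    Lambda.kill r {α} (Lambda.map Subtype.val z) = Lambda.map Subtype.val z := by
  rw [← map_val_forgetEdge, forgetEdge_map_val]

theorem OGraph.isWalk_delete_iff {Γ : OGraph V E} {α : E} {w : List ({e : E // e ≠ α} × Bool)}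
    {u v : V} : (Γ.delete α).IsWalk u w v ↔ Γ.IsWalk u (w.map (Prod.map Subtype.val id)) v := by
  induction w generalizing u with
  | nil => rfl
  | cons d w ih => exact and_congr Iff.rfl ih

theorem map_val_mem_circuitIdeal {r : ℕ} {Γ : OGraph V E} {α : E}
    {z : Lambda r {e : E // e ≠ α}} (hz : z ∈ circuitIdeal r (Γ.delete α) Set.univ) :
    Lambda.map Subtype.val z ∈ circuitIdeal r Γ {α}ᶜ := by
  refine map_mem_of_mem_circuitIdeal _ _ ?_ hz
  rintro w ⟨hne, v, hw⟩ -
  rw [map_arnold]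
  refine arnold_mem_circuitIdeal ⟨by simpa using hne, v, OGraph.isWalk_delete_iff.mp hw⟩ ?_
  intro d hd
  obtain ⟨d', -, rfl⟩ := List.mem_map.mp hd
  exact d'.1.2

theorem forgetEdge_mem_circuitIdeal {r : ℕ} {Γ : OGraph V E} {α : E} {x : Lambda r E}
    (hx : x ∈ circuitIdeal r Γ {α}ᶜ) :
    forgetEdge r α x ∈ circuitIdeal r (Γ.delete α) Set.univ := by
  refine map_mem_of_mem_circuitIdeal _ _ ?_ hx
  rintro w ⟨hne, v, hw⟩ hα
  obtain ⟨w, rfl⟩ : ∃ w' : List ({e : E // e ≠ α} × Bool), w'.map (Prod.map Subtype.val id) = w := by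
    clear hne hw
    induction w with
    | nil => exact ⟨[], rfl⟩
    | cons d w ih =>
      obtain ⟨w', rfl⟩ := ih fun d hd => hα d (by simp [hd])
      exact ⟨(⟨d.1, hα d (by simp)⟩, d.2) :: w', rfl⟩
  rw [← map_arnold, forgetEdge_map_val]
  exact arnold_mem_circuitIdeal ⟨by simpa using hne, v, OGraph.isWalk_delete_iff.mpr hw⟩ (by simp)

theorem insert_compl_singleton (α : E) : insert α ({α}ᶜ : Set E) = Set.univ := by
  ext e
  simp [em]

/-- `Λ^r(Γ ∖ α)` is identified with the elements of `Λ^r[E]` free of `e_α`, with `forgetEdge` as a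
retraction. -/
theorem deletionMap_injective (r : ℕ) (Γ : OGraph V E) {α : E} (hα : Γ.src α ≠ Γ.tgt α) :
    Function.Injective (deletionMap r Γ α) := by
  rw [injective_iff_map_eq_zero]
  intro a ha
  obtain ⟨z, rfl⟩ := R.mk_surjective r _ a
  have ha' : R.mk r Γ (Lambda.map Subtype.val z) = 0 := ha
  rw [R.mk_eq_zero_iff, ← insert_compl_singleton α] at ha'
  have := deletionInjective r Γ {α}ᶜ α (by simp) hα _ ha' (kill_map_val z)
  rw [R.mk_eq_zero_iff, ← forgetEdge_map_val z]
  exact forgetEdge_mem_circuitIdeal this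

/-! ### The graded tensor product -/

theorem tensorInl_mul_tensorInr_eq_tmul (r : ℕ) (Γ : OGraph V E) (a : R r Γ)
    (b : Lambda r Unit) : tensorInl r Γ a * tensorInr r Γ b =
      GradedTensorProduct.tmul ℤ (𝒜 := R.grading r Γ) (ℬ := Lambda.grading r Unit) a b :=
  GradedTensorProduct.tmul_one_mul_one_tmul _ _ a b

/-- The map `R^r(Γ) ⊗ Λ^r[e] → R^r(Γ)` that applies a linear form to the second factor. -/
def tensorEval (r : ℕ) (Γ : OGraph V E) (f : Lambda r Unit →ₗ[ℤ] ℤ) :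
    RTensor r Γ →ₗ[ℤ] R r Γ :=
  (TensorProduct.rid ℤ (R r Γ)).toLinearMap ∘ₗ LinearMap.lTensor (R r Γ) f ∘ₗ
    (GradedTensorProduct.of ℤ (R.grading r Γ) (Lambda.grading r Unit)).symm.toLinearMap

theorem tensorEval_mul (r : ℕ) (Γ : OGraph V E) (f : Lambda r Unit →ₗ[ℤ] ℤ) (a : R r Γ)
    (b : Lambda r Unit) :
    tensorEval r Γ f (tensorInl r Γ a * tensorInr r Γ b) = f b • a := by
  rw [tensorInl_mul_tensorInr_eq_tmul]
  rfl

theorem tensorEval_tensorInl (r : ℕ) (Γ : OGraph V E) (f : Lambda r Unit →ₗ[ℤ] ℤ) (a : R r Γ) :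
    tensorEval r Γ f (tensorInl r Γ a) = f 1 • a := by
  rw [← tensorEval_mul, map_one, mul_one]

/-- The augmentation of `Λ^r[X]`, which sends the generators to zero. -/
def augmentation (r : ℕ) (X : Type*) : Lambda r X →+* ℤ :=
  Lambda.lift (fun _ => 0) (by simp) (by simp)

theorem tensorInl_injective (r : ℕ) (Γ : OGraph V E) : Function.Injective (tensorInl r Γ) := by
  intro a b h
  have h' := congrArg (tensorEval r Γ (augmentation r Unit).toAddMonoidHom.toIntLinearMap) h
  simpa [tensorEval_tensorInl] using h'

/-- The coefficient of `e` in `Λ^r[e]`. -/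
def genCoeff (r : ℕ) : Lambda r Unit →ₗ[ℤ] ℤ :=
  ((augmentation r Unit).toAddMonoidHom.comp (Lambda.residue r ())).toIntLinearMap

theorem genCoeff_one (r : ℕ) : genCoeff r 1 = 0 := by
  have : Lambda.residue r () 1 = 0 := by simpa using Lambda.residue_intCast (r := r) () 1
  simp [genCoeff, this]

theorem genCoeff_gen (r : ℕ) : genCoeff r (Lambda.gen r ()) = 1 := by
  simp [genCoeff, Lambda.residue_gen_self]

theorem tensorInr_gen_mul_tensorInl_mk (r : ℕ) (Γ : OGraph V E) (z : Lambda r E) :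
    tensorInr r Γ (Lambda.gen r ()) * tensorInl r Γ (R.mk r Γ z) =
      tensorInl r Γ (R.mk r Γ (Lambda.twist r E z)) * tensorInr r Γ (Lambda.gen r ()) := by
  induction z using Lambda.induction with
  | hint n => simp only [map_intCast]; exact (Int.cast_commute n _).eq.symm
  | hgen x =>
    rw [Lambda.twist_gen, map_zsmul, map_zsmul, smul_mul_assoc]
    exact tensorInr_mul_tensorInl r Γ x ()
  | hadd a b ha hb => simp only [map_add, mul_add, add_mul, ha, hb]
  | hmul a b ha hb => rw [map_mul, map_mul, ← mul_assoc, ha, mul_assoc, hb, ← mul_assoc, map_mul,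
      map_mul, map_mul]

theorem twist_mem_circuitIdeal {r : ℕ} {Γ : OGraph V E} {S : Set E} {x : Lambda r E}
    (hx : x ∈ circuitIdeal r Γ S) : Lambda.twist r E x ∈ circuitIdeal r Γ S := by
  refine map_mem_of_mem_circuitIdeal _ _ (fun w hw hS => ?_) hx
  rw [twist_arnold]
  exact zsmul_mem (arnold_mem_circuitIdeal hw hS) _

/-- Comparing coefficients of `e` shows that the twist of `z` is a relation, and relations are
stable under `twist`. -/
theorem mk_eq_zero_of_tensorInl_add_eq {r : ℕ} {Γ : OGraph V E} {a y : R r Γ} {z : Lambda r E}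
    (h : tensorInl r Γ a + tensorInr r Γ (Lambda.gen r ()) * tensorInl r Γ (R.mk r Γ z) =
      tensorInl r Γ y) : R.mk r Γ z = 0 := by
  have h' := congrArg (tensorEval r Γ (genCoeff r)) h
  rw [tensorInr_gen_mul_tensorInl_mk, map_add, tensorEval_mul, tensorEval_tensorInl,
    tensorEval_tensorInl, genCoeff_one, genCoeff_gen, zero_smul, zero_smul, zero_add, one_smul,
    R.mk_eq_zero_iff] at h'
  rw [R.mk_eq_zero_iff, ← Lambda.twist_twist r z]
  exact twist_mem_circuitIdeal h'

/-! ### The map `ψ_α` -/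

section psi

variable {r : ℕ} {Γ : OGraph V E} {α : E}

theorem psiLambda_map_val (z : Lambda r {e : E // e ≠ α}) :
    psiLambda r Γ α (Lambda.map Subtype.val z) =
      tensorInl r (Γ.contract α) (R.mk r (Γ.contract α) z) := by
  have : (psiLambda r Γ α).comp (Lambda.map Subtype.val) =
      (tensorInl r (Γ.contract α)).comp (R.mk r (Γ.contract α)) :=
    Lambda.hom_ext fun x => by simp [psiLambda, psiGen, x.2, R.gen]
  exact RingHom.congr_fun this z

theorem psiLambda_gen_self :
    psiLambda r Γ α (Lambda.gen r α) = tensorInr r (Γ.contract α) (Lambda.gen r ()) := by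
  simp [psiLambda, psiGen]

theorem psi_mk (hα : Γ.src α ≠ Γ.tgt α) (x : Lambda r E) :
    psi r Γ α hα (R.mk r Γ x) = psiLambda r Γ α x := rfl

theorem psi_deletionMap (hα : Γ.src α ≠ Γ.tgt α) (a : R r (Γ.delete α)) :
    psi r Γ α hα (deletionMap r Γ α a) =
      tensorInl r (Γ.contract α) (deletionToContraction r Γ α a) := by
  obtain ⟨z, rfl⟩ := R.mk_surjective r _ a
  have h : Lambda.map id z = z := by
    have : Lambda.map id = RingHom.id (Lambda r {e : E // e ≠ α}) := Lambda.hom_ext fun x => by simp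
    rw [this]
    rfl
  have h1 : deletionMap r Γ α (R.mk r _ z) = R.mk r Γ (Lambda.map Subtype.val z) := rfl
  have h2 : deletionToContraction r Γ α (R.mk r _ z) =
    R.mk r (Γ.contract α) (Lambda.map id z) := rfl
  rw [h1, h2, h, psi_mk, psiLambda_map_val]

theorem psi_surjective (hα : Γ.src α ≠ Γ.tgt α) : Function.Surjective (psi r Γ α hα) := by
  have hl (a : R r (Γ.contract α)) : tensorInl r (Γ.contract α) a ∈ (psi r Γ α hα).range := by
    obtain ⟨z, rfl⟩ := R.mk_surjective r _ a
    exact ⟨R.mk r Γ (Lambda.map Subtype.val z), psiLambda_map_val z⟩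
  have hr (b : Lambda r Unit) : tensorInr r (Γ.contract α) b ∈ (psi r Γ α hα).range := by
    induction b using Lambda.induction with
    | hint n => rw [map_intCast]; exact intCast_mem _ n
    | hgen x => exact ⟨R.mk r Γ (Lambda.gen r α), psiLambda_gen_self⟩
    | hadd a b ha hb => rw [map_add]; exact add_mem ha hb
    | hmul a b ha hb => rw [map_mul]; exact mul_mem ha hb
  intro t
  obtain ⟨t, rfl⟩ := (GradedTensorProduct.of ℤ (R.grading r (Γ.contract α))
    (Lambda.grading r Unit)).surjective t
  change _ ∈ (psi r Γ α hα).range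
  induction t using TensorProduct.induction_on with
  | zero => rw [map_zero]; exact zero_mem _
  | tmul a b =>
    have := mul_mem (hl a) (hr b)
    rwa [tensorInl_mul_tensorInr_eq_tmul] at this
  | add s t hs ht => rw [map_add]; exact add_mem hs ht

theorem exists_deletionMap_eq (hα : Γ.src α ≠ Γ.tgt α) {x : R r Γ} {y : R r (Γ.contract α)}
    (h : psi r Γ α hα x = tensorInl r (Γ.contract α) y) :
    ∃ a, deletionMap r Γ α a = x := by
  obtain ⟨x, rfl⟩ := R.mk_surjective r _ x
  have hx := Lambda.eq_kill_add_gen_mul_residue α x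
  have hres : Lambda.residue r α x ∈ circuitIdeal r (Γ.contractAll α) {α}ᶜ := by
    rw [psi_mk, hx, ← Lambda.kill_residue_self, ← map_val_forgetEdge, ← map_val_forgetEdge,
      map_add, map_mul, psiLambda_map_val, psiLambda_map_val, psiLambda_gen_self] at h
    have hz := R.mk_eq_zero_iff.mp (mk_eq_zero_of_tensorInl_add_eq h)
    have := map_val_mem_circuitIdeal (Γ := Γ.contractAll α) hz
    rwa [map_val_forgetEdge, Lambda.kill_residue_self] at this
  obtain ⟨a, ha, hm⟩ := circuitIdeal_contractAll_le (by simp) hres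
  rw [insert_compl_singleton, ← R.mk_eq_zero_iff] at hm
  -- Modulo the relation `a + e_α * residue`, the element `x` equals `kill x - a`, which is free of
  -- `e_α`.
  refine ⟨R.mk r _ (forgetEdge r α (Lambda.kill r {α} x - a)), ?_⟩
  have h1 : deletionMap r Γ α (R.mk r _ (forgetEdge r α (Lambda.kill r {α} x - a))) =
    R.mk r Γ (Lambda.map Subtype.val (forgetEdge r α (Lambda.kill r {α} x - a))) := rfl
  rw [h1, map_val_forgetEdge, map_sub, ha, Lambda.kill_self, eq_comm, ← sub_eq_zero, ← map_sub,
    ← hm]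
  congr 1
  conv_lhs => arg 1; rw [hx]
  abel

end psi

end GraphRing

end

/-! ### The pullback square. -/

theorem theorem1 {V : Type*} {E : Type*} (r : ℕ) (Γ : GraphRing.OGraph V E) (α : E)
    (hα : Γ.src α ≠ Γ.tgt α) :
    IsPullback
      (RingCat.ofHom (GraphRing.deletionToContraction r Γ α))
      (RingCat.ofHom (GraphRing.deletionMap r Γ α))
      (RingCat.ofHom (GraphRing.tensorInl r (Γ.contract α)))
      (RingCat.ofHom (GraphRing.psi r Γ α hα)) ∧
    Function.Injective (GraphRing.deletionMap r Γ α) ∧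
    Function.Surjective (GraphRing.psi r Γ α hα) := by
  refine ⟨?_, GraphRing.deletionMap_injective r Γ hα, GraphRing.psi_surjective hα⟩
  have hcomm : RingCat.ofHom (GraphRing.deletionToContraction r Γ α) ≫
      RingCat.ofHom (GraphRing.tensorInl r (Γ.contract α)) =
      RingCat.ofHom (GraphRing.deletionMap r Γ α) ≫ RingCat.ofHom (GraphRing.psi r Γ α hα) := by
    ext a
    exact (GraphRing.psi_deletionMap hα a).symm
  -- It suffices to check the square on underlying sets. Uniqueness comes from injectivity of `i_α`;
  -- once a preimage of `x` is found, injectivity of `ι_α` forces its image in `R(Γ / α)` to be `y`.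
  refine IsPullback.of_map (forget RingCat) hcomm ?_
  rw [CategoryTheory.Limits.Types.isPullback_iff]
  refine ⟨?_, ?_, ?_⟩
  · rw [← Functor.map_comp, ← Functor.map_comp, hcomm]
  · rintro a b ⟨-, h⟩
    exact GraphRing.deletionMap_injective r Γ hα h
  · intro y x h
    obtain ⟨a, ha⟩ := GraphRing.exists_deletionMap_eq hα (Eq.symm h)
    refine ⟨a, GraphRing.tensorInl_injective r (Γ.contract α) ?_, ha⟩
    refine (GraphRing.psi_deletionMap hα a).symm.trans ?_
    rw [ha]
    exact Eq.symm h
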